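/- **Definitions.** All boxes are open intervals symmetric about $0$. A *(real) type I box mapping $\phi$ of rank $n$* consists of two boxes $B_n\subset B_{n'}$, where $B_n=(-r,r)$, $B_{n'}=(-R,R)$ and $0<r<R$, and a map $\phi$ defined on a set $U$ with $B_n\subset U\subset B_{n'}$ and $\partial B_n\cap U=\emptyset$, such that: * (central branch) on $B_n$, $\phi(x)=h(x^2)$, where $h$ is a $C^3$ diffeomorphism with nonpositive Schwarzian derivative from an open interval onto $B_{n'}$, and $|\phi(x)|\to R$ as $|x|\to r$; * (monotone branches) every other connected component $D$ of $U$ is mapped by $\phi$ onto $B_n$, and $\phi|_D$ is the restriction of a $C^3$ diffeomorphism with nonpositive Schwarzian derivative from an open interval $\hat D$ with $D\subset\hat D\subset B_{n'}\setminus B_n$ onto $B_{n'}$. (The integer $n$ is a label; only the part of the mapping inside $B_{n'}$ is considered, since inducing takes place there.) For $\epsilon>0$, the central branch is *$\epsilon$-extendable* if on $B_n$ it can be written as $\phi(x)=h(x^2)$ with $h$ a $C^3$ diffeomorphism with nonpositive Schwarzian derivative from an open interval onto $((-1-\epsilon)R,(1+\epsilon)R)$. *Filling-in.* If $F$ is a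 map with domain $S$ and $b$ is a box, then the first entry map of $F$ into $b$ sends $x$ to $F^j(x)$, where $j\ge1$, $F^i(x)\in S\setminus b$ for $0\le i<j$ and $F^j(x)\in b$; it is defined where such a $j$ exists. *Standard inducing step, non-close return:* this is the case $\phi(0)\in U\setminus B_n$. On $\{x\in B_n:\phi(x)\in U\}$ let $P(x)=\phi(x)$ if $\phi(x)\in B_n$ and $P(x)=\phi(\phi(x))$ otherwise. Then $B_{(n+1)'}=B_n$, $B_{n+1}$ is the component of the domain of $P$ that contains $0$, and the new mapping, of rank $n+1$, is $P$ on $B_{n+1}$ and the first entry map of $P$ into $B_{n+1}$ on the rest of $B_{(n+1)'}$, where defined. *Standard inducing step, close return:* this is the case $\phi(0)\in B_n$. Let $B^0=B_n$, and let $B^{i+1}=\{x\in B_n:\phi(x)\in B^i\}$. The step is defined if some $B^k$ does not contain $\phi(0)$; take the smallest such $k\ge1$. Let $E(x)=\phi^{i+1}(x)$ if $i\le k$, $x,\dots,\phi^{i-1}(x)\in B_n$ and $\phi^i(x)\in U\setminus B_n$. Let $\tilde\phi$ be the mapping with boxes $B^k\subset B^{k-1}$ that equals $\phi$ on $B^k$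 and, on the rest of $B^{k-1}$, the first entry map of $E$ into $B^k$, where defined. The new mapping, of rank $n+1$, is obtained from $\tilde\phi$ by the step for non-close returns, provided $\tilde\phi$ is defined at $\phi(0)$; in particular $B_{(n+1)'}=B^k$. **Statement.** There is a continuous function $K:\mathbb R\to\mathbb R$ with $K(\epsilon)>0$ for all $\epsilon>0$ such that the following holds for every $\epsilon>0$. Let $\phi$ be a type I box mapping of rank $n$ with $$\frac{|B_n|}{|B_{n'}|}\le 1-\epsilon$$ whose central branch is $\epsilon$-extendable. If a mapping of rank $m$, with boxes $B_m\subset B_{m'}$, is obtained from $\phi$ in a finite number (possibly zero) of standard inducing steps, then $$\frac{|B_m|}{|B_{m'}|}\le 1-K(\epsilon).$$ -/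

import Mathlib

open Set Filter Topology

/-- The Schwarzian derivative `g'''/g' - (3/2) (g''/g')^2`. -/
noncomputable def schwarzian (g : ℝ → ℝ) (x : ℝ) : ℝ :=
  iteratedDeriv 3 g x / deriv g x - 3 / 2 * (iteratedDeriv 2 g x / deriv g x) ^ 2

/-- `g` restricts to a `C³` diffeomorphism with nonpositive Schwarzian derivative from the open
interval `J` (possibly unbounded) onto `I`. -/
structure IsNonposSchwarzDiffeo (g : ℝ → ℝ) (J I : Set ℝ) : Prop where
  isOpen : IsOpen J
  ordConnected : J.OrdConnected
  contDiffOn : ContDiffOn ℝ 3 g J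
  deriv_ne_zero : ∀ x ∈ J, deriv g x ≠ 0
  bijOn : BijOn g J I
  schwarzian_nonpos : ∀ x ∈ J, schwarzian g x ≤ 0

/-- The raw data of a real box mapping, restricted to its box `B' = (-outer, outer)`: the central
box is `B = (-inner, inner)`, the mapping is defined on `dom` and given there by `toFun`
(the values of `toFun` outside `dom` carry no information). -/
structure BoxMap where
  outer : ℝ
  inner : ℝ
  dom : Set ℝ
  toFun : ℝ → ℝ

namespace BoxMap

/-- The box `B' = B_{n'}`. -/
def outerBox (φ : BoxMap) : Set ℝ := Ioo (-φ.outer) φ.outer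

/-- The central box `B = B_n`. -/
def innerBox (φ : BoxMap) : Set ℝ := Ioo (-φ.inner) φ.inner

/-- The box ratio `|B| / |B'|`. -/
noncomputable def ratio (φ : BoxMap) : ℝ := (2 * φ.inner) / (2 * φ.outer)

/-- The central branch is `ε`-extendable: it has the form `x ↦ h (x ^ 2)`, where `h` is a
diffeomorphism with nonpositive Schwarzian derivative from an open interval onto the interval
`(1 + ε) B'`, concentric with `B'`. -/
def CentralExtendable (φ : BoxMap) (ε : ℝ) : Prop :=
  ∃ (h : ℝ → ℝ) (J : Set ℝ),
    IsNonposSchwarzDiffeo h J (Ioo (-((1 + ε) * φ.outer)) ((1 + ε) * φ.outer)) ∧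
    ∀ x ∈ φ.innerBox, x ^ 2 ∈ J ∧ φ.toFun x = h (x ^ 2)

/-- Type I box mappings. -/
structure IsTypeI (φ : BoxMap) : Prop where
  inner_pos : 0 < φ.inner
  inner_lt_outer : φ.inner < φ.outer
  dom_subset : φ.dom ⊆ φ.outerBox
  /-- the central box is a connected component of the domain -/
  innerBox_subset : φ.innerBox ⊆ φ.dom
  inner_notMem : φ.inner ∉ φ.dom
  neg_inner_notMem : -φ.inner ∉ φ.dom
  /-- the central branch folds `B` into `B'`: it is a quadratic map followed by a diffeomorphism
  whose range is `B'` ... -/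
  central : φ.CentralExtendable 0
  /-- ... and it sends the boundary of `B` into the boundary of `B'` -/
  central_proper : Tendsto (fun x => |φ.toFun x|) (𝓝[<] φ.inner) (𝓝 φ.outer)
  /-- every other branch maps its domain, a component of the domain of `φ`, onto `B`, and is the
  restriction of a diffeomorphism, with nonpositive Schwarzian derivative, of an interval
  `D ⊆ B' \ B` onto `B'` -/
  monotone : ∀ x ∈ φ.dom \ φ.innerBox, ∃ (g : ℝ → ℝ) (D : Set ℝ),
    IsNonposSchwarzDiffeo g D φ.outerBox ∧
    D ⊆ φ.outerBox \ φ.innerBox ∧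
    connectedComponentIn φ.dom x ⊆ D ∧
    EqOn φ.toFun g (connectedComponentIn φ.dom x) ∧
    φ.toFun '' connectedComponentIn φ.dom x = φ.innerBox

end BoxMap

/-- `y` is the point of first entry into `b` (after at least one iterate) of the orbit of `x ∉ b`
under the map `F`, whose domain of definition is `S`. -/
def FirstEntry (F : ℝ → ℝ) (S b : Set ℝ) (x y : ℝ) : Prop :=
  ∃ j : ℕ, 1 ≤ j ∧ (∀ i < j, F^[i] x ∈ S \ b) ∧ F^[j] x ∈ b ∧ y = F^[j] x

namespace BoxMap

/-- Filling-in: on its central box `b` the mapping `ψ` is `central`, and on the rest of its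
larger box it is the first entry map into `b` under the map `F` with domain `S`. -/
structure IsFilling (ψ : BoxMap) (central F : ℝ → ℝ) (S : Set ℝ) : Prop where
  dom_eq : ψ.dom =
    ψ.innerBox ∪ {x | x ∈ ψ.outerBox ∧ ∃ y, FirstEntry F S ψ.innerBox x y}
  eq_central : EqOn ψ.toFun central ψ.innerBox
  eq_entry : ∀ x ∈ ψ.outerBox, ∀ y, FirstEntry F S ψ.innerBox x y → ψ.toFun x = y

/-- Domain of the parent branches: the points of `B` sent by the central branch into a
branch domain of `φ` (the central one or a monotone one). -/
def parentDom (φ : BoxMap) : Set ℝ := {x | x ∈ φ.innerBox ∧ φ.toFun x ∈ φ.dom}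

open Classical in
/-- The parent branches: the central branch followed by the identity if it leads to `B`
(immediate branches), and by the monotone branch onto `B` otherwise. -/
noncomputable def parentMap (φ : BoxMap) (x : ℝ) : ℝ :=
  if φ.toFun x ∈ φ.innerBox then φ.toFun x else φ.toFun (φ.toFun x)

/-- The inducing step in the case of a non-close return, when the critical value lies in the
domain of a monotone branch. The new boxes are `B` and the central parent domain; the monotone
parent branches, which map onto `B`, are filled in so as to map onto the new central box. -/
structure IsNonCloseStep (φ ψ : BoxMap) : Prop where
  nonClose : φ.toFun 0 ∈ φ.dom \ φ.innerBox
  outer_eq : ψ.outer = φ.inner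
  innerBox_eq : ψ.innerBox = connectedComponentIn φ.parentDom 0
  filling : ψ.IsFilling φ.parentMap φ.parentMap φ.parentDom

/-- `B^i`, the `i`-th preimage of `B = B^0` by the central branch. -/
def centralPreimage (φ : BoxMap) (i : ℕ) : Set ℝ := {x | ∀ j ≤ i, φ.toFun^[j] x ∈ φ.innerBox}

/-- Points that leave `B` after `i ≤ k` iterates of the central branch and land in
the domain of a monotone branch. -/
def escapeDom (φ : BoxMap) (k : ℕ) : Set ℝ :=
  {x | ∃ i ≤ k, (∀ j < i, φ.toFun^[j] x ∈ φ.innerBox) ∧ φ.toFun^[i] x ∈ φ.dom \ φ.innerBox}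

/-- Iterate the central branch until the point leaves `B`, then apply a monotone branch. -/
noncomputable def escapeMap (φ : BoxMap) (x : ℝ) : ℝ :=
  φ.toFun^[sInf {i : ℕ | φ.toFun^[i] x ∉ φ.innerBox} + 1] x

/-- First stage of the inducing step in the case of a close return: the critical value lies in
`B^l` but not in `B^(l+1)`. The new boxes are `B^l` and `B^(l+1)`, the central branch is
restricted to `B^(l+1)`, and the branches of the escape map, which map onto `B`, are filled in
so as to map onto `B^(l+1)`. -/
structure IsCloseStage (φ : BoxMap) (l : ℕ) (ψ : BoxMap) : Prop where
  close : φ.toFun 0 ∈ φ.centralPreimage l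
  escape : φ.toFun 0 ∉ φ.centralPreimage (l + 1)
  outerBox_eq : ψ.outerBox = φ.centralPreimage l
  innerBox_eq : ψ.innerBox = φ.centralPreimage (l + 1)
  filling : ψ.IsFilling φ.toFun φ.escapeMap (φ.escapeDom (l + 1))

/-- A standard inducing step. After a close return the first stage is followed by the step for
non-close returns. -/
def IsStandardStep (φ ψ : BoxMap) : Prop :=
  IsNonCloseStep φ ψ ∨
    ∃ (l : ℕ) (χ : BoxMap), IsCloseStage φ l χ ∧ IsNonCloseStep χ ψ

/-- `ObtainedBySteps φ n m ψ`: the mapping `ψ`, of rank `m`, is obtained from `φ`, of rank `n`, in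
a finite number of standard inducing steps. Each step raises the rank by one. -/
inductive ObtainedBySteps (φ : BoxMap) (n : ℕ) : ℕ → BoxMap → Prop where
  | refl : ObtainedBySteps φ n n φ
  | step {m : ℕ} {ψ χ : BoxMap} :
      ObtainedBySteps φ n m ψ → IsStandardStep ψ χ → ObtainedBySteps φ n (m + 1) χ

end BoxMap

/-! Maps with nonpositive Schwarzian derivative, and squaring on a half-line, do not decrease the
cross-ratio `(y - x) * (q - p) / ((x - p) * (q - y))`; hence neither do their compositions. Letting
the outer points run to the ends of the range gives Koebe-type inequalities (`le_right`, `le_left`).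

Up to sign the central branch is `H (x ^ 2)` with `H` increasing and extendable over `(-X, X)`. In a
non-close step let `u`, `v`, `s` be the half-lengths of the outer box, the central box and the new
central box, `c = H 0`, `E = H (s ^ 2)`, and let the branch at the critical value extend over `(-Q,
Q)`. Then the new central branch extends over `(-Q, Q)`. `H` gives one inequality between these
numbers and the branch gives two (`StepEstimate`). That branch avoids `(-v, v)`, so the return is
low (`v ≤ c`) or high (`E ≤ -v`). Combining the inequalities cancels the unknown distances to the
ends of the outer box and bounds `s / v`.

The ratio bound itself is an output and is not fed back. What is propagated, with a fixed `α`, is a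
pair of alternatives (`BoundedGeometry`): the outer box is well inside the range of extension or the
ratio is at most `5/6`; and, when `H 0 > 0`, the central box or the critical value is well inside
the outer box. `StepEstimate.bounds` recovers both with the same `α`, so nothing deteriorates, and
yields the ratio `1 - α ^ 2 / 18`. A close return reduces to a non-close step: its first stage only
restricts the central branch, so `H` and `X` survive, and the new monotone branches still extend
over the original outer box. -/

/-- `f` is a homeomorphism between the order-connected sets `J` and `I` that does not decrease
cross-ratios. -/
structure CrossRatioExpanding (f : ℝ → ℝ) (J I : Set ℝ) : Prop where
  ordConnected : J.OrdConnected
  continuousOn : ContinuousOn f J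
  strict : StrictMonoOn f J ∨ StrictAntiOn f J
  bijOn : BijOn f J I
  cross : ∀ p ∈ J, ∀ x ∈ J, ∀ y ∈ J, ∀ q ∈ J, p < x → x < y → y < q →
    (y - x) * (q - p) * (|f x - f p| * |f q - f y|) ≤
      |f y - f x| * |f q - f p| * ((x - p) * (q - y))

/-! ### Nonpositive Schwarzian derivative and cross-ratios -/

section Schwarzian

variable {f f₁ f₂ f₃ : ℝ → ℝ} {J : Set ℝ}

/-- The second derivative of `f₁ ^ (-1/2)` is `-1/2` times the Schwarzian derivative times `f₁ ^
(-1/2)`. -/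
theorem convexOn_rpow_of_schwarzian_nonpos (hJo : IsOpen J) (hJ : J.OrdConnected)
    (h₂ : ∀ x ∈ J, HasDerivAt f₁ (f₂ x) x) (h₃ : ∀ x ∈ J, HasDerivAt f₂ (f₃ x) x)
    (hpos : ∀ x ∈ J, 0 < f₁ x)
    (hS : ∀ x ∈ J, f₃ x / f₁ x - 3 / 2 * (f₂ x / f₁ x) ^ 2 ≤ 0) :
    ConvexOn ℝ J (fun t => f₁ t ^ (-(1 / 2) : ℝ)) := by
  have d1 : ∀ x ∈ J, HasDerivAt (fun t => f₁ t ^ (-(1 / 2) : ℝ))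
      (f₂ x * (-(1 / 2)) * f₁ x ^ (-(1 / 2) - 1 : ℝ)) x := fun x hx =>
    (h₂ x hx).rpow_const (Or.inl (hpos x hx).ne')
  have d2 : ∀ x ∈ J, HasDerivAt (fun x => f₂ x * (-(1 / 2)) * f₁ x ^ (-(1 / 2) - 1 : ℝ))
      (f₃ x * (-(1 / 2)) * f₁ x ^ (-(1 / 2) - 1 : ℝ) +
        f₂ x * (-(1 / 2)) * (f₂ x * (-(1 / 2) - 1) * f₁ x ^ (-(1 / 2) - 1 - 1 : ℝ))) x :=
    fun x hx => ((h₃ x hx).mul_const _).mul ((h₂ x hx).rpow_const (Or.inl (hpos x hx).ne'))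
  have ev : ∀ x ∈ J, deriv (fun t => f₁ t ^ (-(1 / 2) : ℝ)) =ᶠ[𝓝 x]
      (fun x => f₂ x * (-(1 / 2)) * f₁ x ^ (-(1 / 2) - 1 : ℝ)) := fun x hx => by
    filter_upwards [hJo.mem_nhds hx] with t ht using (d1 t ht).deriv
  refine convexOn_of_deriv2_nonneg' hJ.convex
    (fun x hx => (d1 x hx).differentiableAt.differentiableWithinAt)
    (fun x hx => ((d2 x hx).congr_of_eventuallyEq (ev x hx)).differentiableAt.differentiableWithinAt)
    fun x hx => ?_
  have hx0 := hpos x hx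
  have e : f₁ x ^ (-(1 / 2) - 1 : ℝ) = f₁ x ^ (-(1 / 2) - 1 - 1 : ℝ) * f₁ x := by
    conv_lhs => rw [show (-(1 / 2) - 1 : ℝ) = (-(1 / 2) - 1 - 1) + 1 by ring,
      Real.rpow_add_one hx0.ne']
  have hS' : f₃ x * f₁ x - 3 / 2 * f₂ x ^ 2 ≤ 0 := by
    have := mul_nonpos_of_nonpos_of_nonneg (hS x hx) (sq_nonneg (f₁ x))
    have e2 : (f₃ x / f₁ x - 3 / 2 * (f₂ x / f₁ x) ^ 2) * f₁ x ^ 2 =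
      f₃ x * f₁ x - 3 / 2 * f₂ x ^ 2 := by field_simp
    rwa [e2] at this
  rw [Function.iterate_succ_apply, Function.iterate_one, ((ev x hx).deriv_eq), (d2 x hx).deriv, e]
  have hp : 0 < f₁ x ^ (-(1 / 2) - 1 - 1 : ℝ) := Real.rpow_pos_of_pos hx0 _
  nlinarith [mul_nonneg hp.le (neg_nonneg.2 hS')]

/-- The convex function `u = f₁ ^ (-1/2)` lies below its chord `ℓ` on `[x, y]`, so `f₁ ≥ ℓ ^ (-2)`.
The integral of `ℓ ^ (-2)` over `[x, y]` is `(y - x) / (u x * u y)`. -/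
theorem deriv_mul_deriv_le_of_schwarzian_nonpos (hJo : IsOpen J) (hJ : J.OrdConnected)
    (h₁ : ∀ x ∈ J, HasDerivAt f (f₁ x) x)
    (h₂ : ∀ x ∈ J, HasDerivAt f₁ (f₂ x) x) (h₃ : ∀ x ∈ J, HasDerivAt f₂ (f₃ x) x)
    (hpos : ∀ x ∈ J, 0 < f₁ x)
    (hS : ∀ x ∈ J, f₃ x / f₁ x - 3 / 2 * (f₂ x / f₁ x) ^ 2 ≤ 0)
    {x y : ℝ} (hx : x ∈ J) (hy : y ∈ J) (hxy : x < y) :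
    f₁ x * f₁ y * (y - x) ^ 2 ≤ (f y - f x) ^ 2 := by
  have hconv := convexOn_rpow_of_schwarzian_nonpos hJo hJ h₂ h₃ hpos hS
  set u : ℝ → ℝ := fun t => f₁ t ^ (-(1 / 2) : ℝ) with hu
  have upos : ∀ t ∈ J, 0 < u t := fun t ht => Real.rpow_pos_of_pos (hpos t ht) _
  have usq : ∀ t ∈ J, f₁ t * u t ^ 2 = 1 := fun t ht => by
    rw [hu, ← Real.rpow_natCast, ← Real.rpow_mul (hpos t ht).le]
    norm_num
    rw [Real.rpow_neg_one, mul_inv_cancel₀ (hpos t ht).ne']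
  have hd : 0 < y - x := sub_pos.2 hxy
  set k := (u y - u x) / (y - x) with hk
  have hky : u x + k * (y - x) = u y := by rw [hk]; field_simp; ring
  have hsub : Icc x y ⊆ J := hJ.out hx hy
  have hle : ∀ t ∈ Icc x y, u t ≤ u x + k * (t - x) := by
    intro t ht
    have h := hconv.2
    specialize h hx hy (div_nonneg (sub_nonneg.2 ht.2) hd.le)
      (div_nonneg (sub_nonneg.2 ht.1) hd.le) (by field_simp; ring)
    have e1 : ((y - t) / (y - x)) • x + ((t - x) / (y - x)) • y = t := by
      simp only [smul_eq_mul]; field_simp; ring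
    rw [e1] at h
    refine h.trans (le_of_eq ?_)
    simp only [smul_eq_mul]
    rw [hk]; field_simp; ring
  have lpos : ∀ t ∈ Icc x y, 0 < u x + k * (t - x) := fun t ht =>
    (upos t (hsub ht)).trans_le (hle t ht)
  have ux := upos x hx
  have dm : ∀ t ∈ Icc x y, HasDerivAt (fun t => f t - (t - x) / (u x * (u x + k * (t - x))))
      (f₁ t - 1 / (u x + k * (t - x)) ^ 2) t := by
    intro t ht
    have hl := lpos t ht
    have := (h₁ t (hsub ht)).sub (((hasDerivAt_id t).sub_const x).div
      ((((((hasDerivAt_id t).sub_const x).const_mul k).const_add (u x))).const_mul (u x))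
      (mul_pos ux hl).ne')
    refine this.congr_deriv ?_
    simp only [id]
    congr 1
    field_simp
    ring
  have hmono : MonotoneOn (fun t => f t - (t - x) / (u x * (u x + k * (t - x)))) (Icc x y) := by
    refine monotoneOn_of_deriv_nonneg (convex_Icc x y)
      (fun t ht => (dm t ht).continuousAt.continuousWithinAt)
      (fun t ht => (dm t (interior_subset ht)).differentiableAt.differentiableWithinAt)
      fun t ht => ?_
    have ht := interior_subset ht
    rw [(dm t ht).deriv, sub_nonneg, div_le_iff₀ (pow_pos (lpos t ht) 2), ← usq t (hsub ht)]
    have := hle t ht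
    have := upos t (hsub ht)
    exact mul_le_mul_of_nonneg_left (by gcongr) (hpos t (hsub ht)).le
  have h := hmono (left_mem_Icc.2 hxy.le) (right_mem_Icc.2 hxy.le) hxy.le
  simp only [sub_self, zero_div, sub_zero, hky] at h
  have uy := upos y hy
  have h' : (y - x) ≤ (f y - f x) * (u x * u y) := by
    rw [← div_le_iff₀ (mul_pos ux uy)]; linarith
  have h2 : (y - x) ^ 2 ≤ ((f y - f x) * (u x * u y)) ^ 2 := pow_le_pow_left₀ hd.le h' 2
  calc f₁ x * f₁ y * (y - x) ^ 2 ≤ f₁ x * f₁ y * ((f y - f x) * (u x * u y)) ^ 2 :=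
        mul_le_mul_of_nonneg_left h2 (mul_pos (hpos x hx) (hpos y hy)).le
    _ = (f₁ x * u x ^ 2) * (f₁ y * u y ^ 2) * (f y - f x) ^ 2 := by ring
    _ = (f y - f x) ^ 2 := by rw [usq x hx, usq y hy]; ring

/-- The preceding bound says `f'(s) f'(t) / (f t - f s) ^ 2 ≤ 1 / (t - s) ^ 2`. Integrating over
`[p, x] × [y, q]` compares the logarithms of two cross-ratios; the identity `(q - x) * (y - p) = (y
- x) * (q - p) + (x - p) * (q - y)` converts them to the form used here. -/
theorem cross_ratio_le_of_schwarzian_nonpos (hJo : IsOpen J) (hJ : J.OrdConnected)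
    (h₁ : ∀ x ∈ J, HasDerivAt f (f₁ x) x)
    (h₂ : ∀ x ∈ J, HasDerivAt f₁ (f₂ x) x) (h₃ : ∀ x ∈ J, HasDerivAt f₂ (f₃ x) x)
    (hpos : ∀ x ∈ J, 0 < f₁ x)
    (hS : ∀ x ∈ J, f₃ x / f₁ x - 3 / 2 * (f₂ x / f₁ x) ^ 2 ≤ 0) (hf : StrictMonoOn f J)
    {p x y q : ℝ} (hp : p ∈ J) (hq : q ∈ J) (hpx : p < x) (hxy : x < y) (hyq : y < q) :
    (y - x) * (q - p) * ((f x - f p) * (f q - f y)) ≤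
      (f y - f x) * (f q - f p) * ((x - p) * (q - y)) := by
  have hsub : Icc p q ⊆ J := hJ.out hp hq
  have hx : x ∈ J := hsub ⟨hpx.le, by linarith⟩
  have hy : y ∈ J := hsub ⟨by linarith, hyq.le⟩
  -- the kernel `f'(s) f'(t) / (f s - f t) ^ 2` integrated in the variable `t`
  have step1 : ∀ s ∈ Icc p x,
      f₁ s / (f y - f s) - f₁ s / (f q - f s) ≤ 1 / (y - s) - 1 / (q - s) := by
    intro s hs
    have hsJ : s ∈ J := hsub ⟨hs.1, by linarith [hs.2]⟩
    have hlt : ∀ t ∈ Icc y q, s < t := fun t ht => by linarith [hs.2, ht.1]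
    have htJ : ∀ t ∈ Icc y q, t ∈ J := fun t ht => hsub ⟨by linarith [ht.1], ht.2⟩
    have hflt : ∀ t ∈ Icc y q, 0 < f t - f s := fun t ht =>
      sub_pos.2 (hf hsJ (htJ t ht) (hlt t ht))
    have dk : ∀ t ∈ Icc y q, HasDerivAt (fun t => f₁ s / (f t - f s) - 1 / (t - s))
        (1 / (t - s) ^ 2 - f₁ s * f₁ t / (f t - f s) ^ 2) t := by
      intro t ht
      have a1 := (hasDerivAt_const t (f₁ s)).div ((h₁ t (htJ t ht)).sub_const (f s))
        (hflt t ht).ne'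
      have a2 := (hasDerivAt_const t (1 : ℝ)).div ((hasDerivAt_id t).sub_const s)
        (sub_pos.2 (hlt t ht)).ne'
      refine (a1.sub a2).congr_deriv ?_
      simp only [id]
      ring
    have hmono : MonotoneOn (fun t => f₁ s / (f t - f s) - 1 / (t - s)) (Icc y q) := by
      refine monotoneOn_of_deriv_nonneg (convex_Icc y q)
        (fun t ht => (dk t ht).continuousAt.continuousWithinAt)
        (fun t ht => (dk t (interior_subset ht)).differentiableAt.differentiableWithinAt)
        fun t ht => ?_
      have ht := interior_subset ht
      rw [(dk t ht).deriv, sub_nonneg, div_le_div_iff₀ (pow_pos (hflt t ht) 2)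
        (pow_pos (sub_pos.2 (hlt t ht)) 2)]
      linarith [deriv_mul_deriv_le_of_schwarzian_nonpos hJo hJ h₁ h₂ h₃ hpos hS hsJ (htJ t ht)
        (hlt t ht)]
    have := hmono (left_mem_Icc.2 hyq.le) (right_mem_Icc.2 hyq.le) hyq.le
    simp only at this
    linarith
  have hlts : ∀ s ∈ Icc p x, ∀ t ∈ ({y, q} : Set ℝ), 0 < t - s ∧ 0 < f t - f s ∧ s ∈ J := by
    intro s hs t ht
    have hsJ : s ∈ J := hsub ⟨hs.1, by linarith [hs.2]⟩
    rcases ht with rfl | rfl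
    · have : s < t := by linarith [hs.2]
      exact ⟨sub_pos.2 this, sub_pos.2 (hf hsJ hy this), hsJ⟩
    · have : s < t := by linarith [hs.2]
      exact ⟨sub_pos.2 this, sub_pos.2 (hf hsJ hq this), hsJ⟩
  have hty : y ∈ ({y, q} : Set ℝ) := by simp
  have htq : q ∈ ({y, q} : Set ℝ) := by simp
  have dG : ∀ s ∈ Icc p x, HasDerivAt
      (fun s => Real.log (f q - f s) - Real.log (f y - f s) -
        (Real.log (q - s) - Real.log (y - s)))
      (f₁ s / (f y - f s) - f₁ s / (f q - f s) - (1 / (y - s) - 1 / (q - s))) s := by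
    intro s hs
    obtain ⟨b1, b2, hsJ⟩ := hlts s hs y hty
    obtain ⟨b3, b4, -⟩ := hlts s hs q htq
    have a1 := ((h₁ s hsJ).const_sub (f q)).log b4.ne'
    have a2 := ((h₁ s hsJ).const_sub (f y)).log b2.ne'
    have a3 := ((hasDerivAt_id s).const_sub q).log b3.ne'
    have a4 := ((hasDerivAt_id s).const_sub y).log b1.ne'
    refine ((a1.sub a2).sub (a3.sub a4)).congr_deriv ?_
    simp only [id]
    ring
  have hanti : AntitoneOn (fun s => Real.log (f q - f s) - Real.log (f y - f s) -
        (Real.log (q - s) - Real.log (y - s))) (Icc p x) := by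
    refine antitoneOn_of_deriv_nonpos (convex_Icc p x)
      (fun t ht => (dG t ht).continuousAt.continuousWithinAt)
      (fun t ht => (dG t (interior_subset ht)).differentiableAt.differentiableWithinAt)
      fun t ht => ?_
    have ht := interior_subset ht
    rw [(dG t ht).deriv]
    linarith [step1 t ht]
  have h := hanti (left_mem_Icc.2 hpx.le) (right_mem_Icc.2 hpx.le) hpx.le
  simp only at h
  obtain ⟨c1, c2, -⟩ := hlts p (left_mem_Icc.2 hpx.le) y hty
  obtain ⟨c3, c4, -⟩ := hlts p (left_mem_Icc.2 hpx.le) q htq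
  obtain ⟨d1, d2, -⟩ := hlts x (right_mem_Icc.2 hpx.le) y hty
  obtain ⟨d3, d4, -⟩ := hlts x (right_mem_Icc.2 hpx.le) q htq
  have hlog : Real.log ((f q - f x) * (f y - f p) * ((y - x) * (q - p))) ≤
      Real.log ((f y - f x) * (f q - f p) * ((q - x) * (y - p))) := by
    rw [Real.log_mul (by positivity) (by positivity), Real.log_mul (by positivity) (by positivity),
      Real.log_mul (by positivity) (by positivity), Real.log_mul (by positivity) (by positivity),
      Real.log_mul (by positivity) (by positivity), Real.log_mul (by positivity) (by positivity)]
    linarith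
  have := (Real.log_le_log_iff (by positivity) (by positivity)).1 hlog
  linarith

end Schwarzian

theorem ContDiffAt.differentiableAt_iteratedDeriv_of_lt {f : ℝ → ℝ} {n : WithTop ℕ∞} {m : ℕ} {x : ℝ}
    (h : ContDiffAt ℝ n f x) (hmn : m < n) : DifferentiableAt ℝ (iteratedDeriv m f) x := by
  rw [iteratedDeriv_eq_equiv_comp, LinearIsometryEquiv.comp_differentiableAt_iff]
  exact h.differentiableAt_iteratedFDeriv hmn

/-- A derivative without zeros on an interval has constant sign, and `-g` has the same Schwarzian
derivative as `g`. -/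
theorem IsNonposSchwarzDiffeo.crossRatioExpanding {g : ℝ → ℝ} {J I : Set ℝ}
    (hg : IsNonposSchwarzDiffeo g J I) : CrossRatioExpanding g J I := by
  have hC : ∀ x ∈ J, ContDiffAt ℝ 3 g x := fun x hx =>
    hg.contDiffOn.contDiffAt (hg.isOpen.mem_nhds hx)
  have e2 : iteratedDeriv 2 g = deriv (deriv g) := by
    rw [iteratedDeriv_succ, iteratedDeriv_one]
  have hd1 : ∀ x ∈ J, HasDerivAt g (deriv g x) x := fun x hx =>
    ((hC x hx).differentiableAt (by norm_num)).hasDerivAt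
  have hd2 : ∀ x ∈ J, HasDerivAt (deriv g) (iteratedDeriv 2 g x) x := fun x hx => by
    rw [e2]
    have := (hC x hx).differentiableAt_iteratedDeriv_of_lt (m := 1) (by norm_num)
    rw [iteratedDeriv_one] at this
    exact this.hasDerivAt
  have hd3 : ∀ x ∈ J, HasDerivAt (iteratedDeriv 2 g) (iteratedDeriv 3 g x) x := fun x hx => by
    rw [iteratedDeriv_succ (n := 2)]
    exact ((hC x hx).differentiableAt_iteratedDeriv_of_lt (m := 2) (by norm_num)).hasDerivAt
  have hS := hg.schwarzian_nonpos
  unfold schwarzian at hS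
  have hcont : ContinuousOn g J := hg.contDiffOn.continuousOn
  rcases hasDerivWithinAt_forall_lt_or_forall_gt_of_forall_ne hg.ordConnected.convex
    (fun x hx => (hd1 x hx).hasDerivWithinAt) hg.deriv_ne_zero with hneg | hpos
  · have hanti : StrictAntiOn g J := strictAntiOn_of_deriv_neg hg.ordConnected.convex hcont
      fun x hx => hneg x (interior_subset hx)
    refine ⟨hg.ordConnected, hcont, Or.inr hanti, hg.bijOn, ?_⟩
    intro p hp x hx y hy q hq hpx hxy hyq
    have := cross_ratio_le_of_schwarzian_nonpos hg.isOpen hg.ordConnected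
      (f := fun x => -g x) (f₁ := fun x => -deriv g x) (f₂ := fun x => -iteratedDeriv 2 g x)
      (f₃ := fun x => -iteratedDeriv 3 g x) (fun x hx => (hd1 x hx).neg)
      (fun x hx => (hd2 x hx).neg) (fun x hx => (hd3 x hx).neg)
      (fun x hx => neg_pos.2 (hneg x hx))
      (fun x hx => by simpa only [neg_div_neg_eq] using hS x hx) (fun a ha b hb hab =>
        neg_lt_neg (hanti ha hb hab)) hp hq hpx hxy hyq
    rw [abs_of_neg (sub_neg.2 (hanti hp hx hpx)), abs_of_neg (sub_neg.2 (hanti hy hq hyq)),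
      abs_of_neg (sub_neg.2 (hanti hx hy hxy)),
      abs_of_neg (sub_neg.2 (hanti hp hq (hpx.trans (hxy.trans hyq))))]
    linarith
  · have hmono : StrictMonoOn g J := strictMonoOn_of_deriv_pos hg.ordConnected.convex hcont
      fun x hx => hpos x (interior_subset hx)
    refine ⟨hg.ordConnected, hcont, Or.inl hmono, hg.bijOn, ?_⟩
    intro p hp x hx y hy q hq hpx hxy hyq
    rw [abs_of_pos (sub_pos.2 (hmono hp hx hpx)), abs_of_pos (sub_pos.2 (hmono hy hq hyq)),
      abs_of_pos (sub_pos.2 (hmono hx hy hxy)),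
      abs_of_pos (sub_pos.2 (hmono hp hq (hpx.trans (hxy.trans hyq))))]
    exact cross_ratio_le_of_schwarzian_nonpos hg.isOpen hg.ordConnected hd1 hd2 hd3 hpos hS hmono
      hp hq hpx hxy hyq

/-! ### Calculus of cross-ratio expanding maps -/

namespace CrossRatioExpanding

variable {f g : ℝ → ℝ} {J J' I I' : Set ℝ}

theorem id {I : Set ℝ} (hI : I.OrdConnected) : CrossRatioExpanding (fun x => x) I I where
  ordConnected := hI
  continuousOn := continuousOn_id
  strict := Or.inl fun _ _ _ _ h => h
  bijOn := bijOn_id I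
  cross := by
    intro p _ x _ y _ q _ h1 h2 h3
    rw [abs_of_pos (sub_pos.2 h1), abs_of_pos (sub_pos.2 h2), abs_of_pos (sub_pos.2 h3),
      abs_of_pos (sub_pos.2 (h1.trans (h2.trans h3)))]

theorem ordConnected_preimage (hf : CrossRatioExpanding f J I) (hJ' : J'.OrdConnected) :
    (J ∩ f ⁻¹' J').OrdConnected := by
  refine ⟨fun a ha b hb t ht => ?_⟩
  have htJ := hf.ordConnected.out ha.1 hb.1 ht
  refine ⟨htJ, ?_⟩
  rcases hf.strict with hm | hm
  · exact hJ'.out ha.2 hb.2 ⟨hm.monotoneOn ha.1 htJ ht.1, hm.monotoneOn htJ hb.1 ht.2⟩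
  · exact hJ'.out hb.2 ha.2 ⟨hm.antitoneOn htJ hb.1 ht.2, hm.antitoneOn ha.1 htJ ht.1⟩

theorem comp (hg : CrossRatioExpanding g J' I') (hf : CrossRatioExpanding f J I) (hJ' : J' ⊆ I) :
    CrossRatioExpanding (fun x => g (f x)) (J ∩ f ⁻¹' J') I' where
  ordConnected := hf.ordConnected_preimage hg.ordConnected
  continuousOn := hg.continuousOn.comp (hf.continuousOn.mono inter_subset_left) fun _ h => h.2
  strict := by
    rcases hf.strict with hm | hm <;> rcases hg.strict with hn | hn
    · exact Or.inl fun a ha b hb h => hn ha.2 hb.2 (hm ha.1 hb.1 h)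
    · exact Or.inr fun a ha b hb h => hn ha.2 hb.2 (hm ha.1 hb.1 h)
    · exact Or.inr fun a ha b hb h => hn hb.2 ha.2 (hm ha.1 hb.1 h)
    · exact Or.inl fun a ha b hb h => hn hb.2 ha.2 (hm ha.1 hb.1 h)
  bijOn := by
    refine ⟨fun x hx => hg.bijOn.mapsTo hx.2, fun a ha b hb h => ?_, fun z hz => ?_⟩
    · exact hf.bijOn.injOn ha.1 hb.1 (hg.bijOn.injOn ha.2 hb.2 h)
    · obtain ⟨w, hw, rfl⟩ := hg.bijOn.surjOn hz
      obtain ⟨v, hv, rfl⟩ := hf.bijOn.surjOn (hJ' hw)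
      exact ⟨v, ⟨hv, hw⟩, rfl⟩
  cross := by
    intro p hp x hx y hy q hq hpx hxy hyq
    have h1 := hf.cross p hp.1 x hx.1 y hy.1 q hq.1 hpx hxy hyq
    have ne : ∀ a ∈ J, ∀ b ∈ J, a < b → 0 < |f b - f a| := fun a ha b hb h =>
      abs_pos.2 (sub_ne_zero.2 fun e => h.ne (hf.bijOn.injOn hb ha e).symm)
    have n1 := ne p hp.1 x hx.1 hpx
    have n3 := ne y hy.1 q hq.1 hyq
    -- A decreasing `f` reverses the four points, which leaves their cross-ratio unchanged.
    have key : |f y - f x| * |f q - f p| * (|g (f x) - g (f p)| * |g (f q) - g (f y)|) ≤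
        |g (f y) - g (f x)| * |g (f q) - g (f p)| * (|f x - f p| * |f q - f y|) := by
      rcases hf.strict with hm | hm
      · have a1 := hm hp.1 hx.1 hpx
        have a2 := hm hx.1 hy.1 hxy
        have a3 := hm hy.1 hq.1 hyq
        have := hg.cross _ hp.2 _ hx.2 _ hy.2 _ hq.2 a1 a2 a3
        rwa [abs_of_pos (sub_pos.2 a1), abs_of_pos (sub_pos.2 a2), abs_of_pos (sub_pos.2 a3),
          abs_of_pos (sub_pos.2 (a1.trans (a2.trans a3)))]
      · have a1 := hm hp.1 hx.1 hpx
        have a2 := hm hx.1 hy.1 hxy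
        have a3 := hm hy.1 hq.1 hyq
        have := hg.cross _ hq.2 _ hy.2 _ hx.2 _ hp.2 a3 a2 a1
        rw [abs_sub_comm (f y), abs_sub_comm (f q) (f p), abs_sub_comm (f x) (f p),
          abs_sub_comm (f q), abs_of_pos (sub_pos.2 a1), abs_of_pos (sub_pos.2 a2),
          abs_of_pos (sub_pos.2 a3), abs_of_pos (sub_pos.2 (a3.trans (a2.trans a1))),
          abs_sub_comm (g (f x)) (g (f p)), abs_sub_comm (g (f q)) (g (f y)),
          abs_sub_comm (g (f y)) (g (f x)), abs_sub_comm (g (f q)) (g (f p))]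
        linarith
    set b' := |f x - f p| * |f q - f y|
    set b'' := |g (f x) - g (f p)| * |g (f q) - g (f y)|
    set c' := |f y - f x| * |f q - f p|
    set c'' := |g (f y) - g (f x)| * |g (f q) - g (f p)|
    have hb' : 0 < b' := mul_pos n1 n3
    have hb'' : 0 ≤ b'' := by positivity
    have hb : 0 < (x - p) * (q - y) := mul_pos (sub_pos.2 hpx) (sub_pos.2 hyq)
    refine le_of_mul_le_mul_right ?_ hb'
    calc (y - x) * (q - p) * b'' * b' = ((y - x) * (q - p) * b') * b'' := by ring
      _ ≤ (c' * ((x - p) * (q - y))) * b'' := mul_le_mul_of_nonneg_right h1 hb''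
      _ = (c' * b'') * ((x - p) * (q - y)) := by ring
      _ ≤ (c'' * b') * ((x - p) * (q - y)) := mul_le_mul_of_nonneg_right key hb.le
      _ = c'' * ((x - p) * (q - y)) * b' := by ring

theorem restrict (hf : CrossRatioExpanding f J I) (hI' : I'.OrdConnected) (h : I' ⊆ I) :
    CrossRatioExpanding f (J ∩ f ⁻¹' I') I' :=
  (CrossRatioExpanding.id hI').comp hf h

theorem mul_sign {σ : ℝ} (hσ : σ = 1 ∨ σ = -1) (hJ : J.OrdConnected)
    (hσJ : ∀ x, σ * x ∈ J ↔ x ∈ J) :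
    CrossRatioExpanding (fun x => σ * x) J J := by
  have hss : ∀ x, σ * (σ * x) = x := fun x => by rcases hσ with rfl | rfl <;> ring
  refine ⟨hJ, by fun_prop, ?_, ⟨fun x hx => (hσJ x).2 hx, fun a _ b _ h => ?_, fun x hx => ?_⟩, ?_⟩
  · rcases hσ with rfl | rfl
    · exact Or.inl fun a _ b _ h => by linarith
    · exact Or.inr fun a _ b _ h => by linarith
  · have := congrArg (σ * ·) h
    simpa only [hss] using this
  · exact ⟨σ * x, (hσJ x).2 hx, hss x⟩
  · intro p _ x _ y _ q _ h1 h2 h3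
    have hab : |σ| = 1 := by rcases hσ with rfl | rfl <;> simp
    simp only [← mul_sub, abs_mul, hab, one_mul]
    rw [abs_of_pos (sub_pos.2 h1), abs_of_pos (sub_pos.2 h2), abs_of_pos (sub_pos.2 h3),
      abs_of_pos (sub_pos.2 (h1.trans (h2.trans h3)))]

/-- After division by the differences, the claim is `(x + p) * (q + y) ≤ (y + x) * (q + p)`, whose
two sides differ by `(y - p) * (q - x)`. -/
theorem sq_Ioi : CrossRatioExpanding (fun x => x ^ 2) (Ioi 0) (Ioi 0) := by
  have hm : StrictMonoOn (fun x : ℝ => x ^ 2) (Ioi 0) := fun a ha b _ h =>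
    pow_lt_pow_left₀ h (le_of_lt ha) two_ne_zero
  refine ⟨ordConnected_Ioi, by fun_prop, Or.inl hm,
    ⟨fun x (hx : 0 < x) => pow_pos hx 2, hm.injOn, fun x (hx : 0 < x) =>
      ⟨√x, Real.sqrt_pos.2 hx, Real.sq_sqrt hx.le⟩⟩, ?_⟩
  intro p hp x hx y hy q hq hpx hxy hyq
  rw [abs_of_pos (sub_pos.2 (hm hp hx hpx)), abs_of_pos (sub_pos.2 (hm hx hy hxy)),
    abs_of_pos (sub_pos.2 (hm hy hq hyq)),
    abs_of_pos (sub_pos.2 (hm hp hq (hpx.trans (hxy.trans hyq))))]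
  have h1 : (x + p) * (q + y) ≤ (y + x) * (q + p) := by
    nlinarith [mul_nonneg (sub_nonneg.2 (hpx.trans hxy).le) (sub_nonneg.2 (hxy.trans hyq).le)]
  have h2 : 0 ≤ (y - x) * (q - p) * ((x - p) * (q - y)) := by
    have := sub_pos.2 hpx; have := sub_pos.2 hxy; have := sub_pos.2 hyq
    have : 0 < q - p := by linarith
    positivity
  have := mul_le_mul_of_nonneg_left h1 h2
  linarith

theorem sq_Iio : CrossRatioExpanding (fun x => x ^ 2) (Iio 0) (Ioi 0) := by
  have h : CrossRatioExpanding (fun x : ℝ => (-1 : ℝ) * x) univ univ :=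
    mul_sign (Or.inr rfl) ordConnected_univ (by simp)
  have := sq_Ioi.comp h (subset_univ _)
  simpa using this

/-- The Koebe-type bound given by a cross-ratio whose outer points tend to the ends. -/
theorem le_right {A B hi x y : ℝ} (hf : CrossRatioExpanding f J (Ioo A B))
    (hm : StrictMonoOn f J) (hJ : ∀ t ∈ J, t ≤ hi) (hx : x ∈ J) (hy : y ∈ J) (hxy : x < y) :
    (y - x) * ((f x - A) * (B - f y)) ≤ (f y - f x) * (B - A) * (hi - y) := by
  have hfx := hf.bijOn.mapsTo hx
  have hfy := hf.bijOn.mapsTo hy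
  have key : ∀ z ∈ Ioo A (f x) ×ˢ Ioo (f y) B,
      (y - x) * ((f x - z.1) * (z.2 - f y)) ≤ (f y - f x) * (z.2 - z.1) * (hi - y) := by
    rintro ⟨P, U⟩ ⟨hP, hU⟩
    obtain ⟨p, hp, rfl⟩ := hf.bijOn.surjOn (show P ∈ Ioo A B from ⟨hP.1, hP.2.trans hfx.2⟩)
    obtain ⟨q, hq, rfl⟩ := hf.bijOn.surjOn (show U ∈ Ioo A B from ⟨hfy.1.trans hU.1, hU.2⟩)
    have hpx : p < x := (hm.lt_iff_lt hp hx).1 hP.2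
    have hyq : y < q := (hm.lt_iff_lt hy hq).1 hU.1
    have h := hf.cross p hp x hx y hy q hq hpx hxy hyq
    have b1 := sub_pos.2 (hm hp hx hpx)
    have b2 := sub_pos.2 (hm hx hy hxy)
    have b3 := sub_pos.2 (hm hy hq hyq)
    have b4 := sub_pos.2 (hm hp hq (hpx.trans (hxy.trans hyq)))
    rw [abs_of_pos b1, abs_of_pos b2, abs_of_pos b3, abs_of_pos b4] at h
    have hqp : 0 < q - p := by linarith
    simp only
    refine le_of_mul_le_mul_left ?_ hqp
    calc (q - p) * ((y - x) * ((f x - f p) * (f q - f y)))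
        = (y - x) * (q - p) * ((f x - f p) * (f q - f y)) := by ring
      _ ≤ _ := h
      -- Nothing is known about `p` beyond `p < x`; the bound `x - p ≤ q - p` lets the factor `q -
      -- p` cancel.
      _ ≤ (f y - f x) * (f q - f p) * ((q - p) * (hi - y)) := by
          refine mul_le_mul_of_nonneg_left ?_ (mul_pos b2 b4).le
          exact mul_le_mul (by linarith) (by linarith [hJ q hq]) (by linarith) hqp.le
      _ = _ := by ring
  have hcl : (A, B) ∈ closure (Ioo A (f x) ×ˢ Ioo (f y) B) := by
    rw [closure_prod_eq, closure_Ioo hfx.1.ne, closure_Ioo hfy.2.ne]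
    exact ⟨left_mem_Icc.2 hfx.1.le, right_mem_Icc.2 hfy.2.le⟩
  exact ContinuousWithinAt.closure_le (f := fun z : ℝ × ℝ => (y - x) * ((f x - z.1) * (z.2 - f y)))
    (g := fun z => (f y - f x) * (z.2 - z.1) * (hi - y)) hcl (by fun_prop) (by fun_prop) key

theorem le_left {A B lo x y : ℝ} (hf : CrossRatioExpanding f J (Ioo A B))
    (hm : StrictMonoOn f J) (hJ : ∀ t ∈ J, lo ≤ t) (hx : x ∈ J) (hy : y ∈ J) (hxy : x < y) :
    (y - x) * ((f x - A) * (B - f y)) ≤ (f y - f x) * (B - A) * (x - lo) := by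
  have hfx := hf.bijOn.mapsTo hx
  have hfy := hf.bijOn.mapsTo hy
  have key : ∀ z ∈ Ioo A (f x) ×ˢ Ioo (f y) B,
      (y - x) * ((f x - z.1) * (z.2 - f y)) ≤ (f y - f x) * (z.2 - z.1) * (x - lo) := by
    rintro ⟨P, U⟩ ⟨hP, hU⟩
    obtain ⟨p, hp, rfl⟩ := hf.bijOn.surjOn (show P ∈ Ioo A B from ⟨hP.1, hP.2.trans hfx.2⟩)
    obtain ⟨q, hq, rfl⟩ := hf.bijOn.surjOn (show U ∈ Ioo A B from ⟨hfy.1.trans hU.1, hU.2⟩)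
    have hpx : p < x := (hm.lt_iff_lt hp hx).1 hP.2
    have hyq : y < q := (hm.lt_iff_lt hy hq).1 hU.1
    have h := hf.cross p hp x hx y hy q hq hpx hxy hyq
    have b1 := sub_pos.2 (hm hp hx hpx)
    have b2 := sub_pos.2 (hm hx hy hxy)
    have b3 := sub_pos.2 (hm hy hq hyq)
    have b4 := sub_pos.2 (hm hp hq (hpx.trans (hxy.trans hyq)))
    rw [abs_of_pos b1, abs_of_pos b2, abs_of_pos b3, abs_of_pos b4] at h
    have hqp : 0 < q - p := by linarith
    simp only
    refine le_of_mul_le_mul_left ?_ hqp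
    calc (q - p) * ((y - x) * ((f x - f p) * (f q - f y)))
        = (y - x) * (q - p) * ((f x - f p) * (f q - f y)) := by ring
      _ ≤ _ := h
      _ ≤ (f y - f x) * (f q - f p) * ((x - lo) * (q - p)) := by
          refine mul_le_mul_of_nonneg_left ?_ (mul_pos b2 b4).le
          exact mul_le_mul (by linarith [hJ p hp]) (by linarith) (by linarith)
            (by linarith [hJ x hx])
      _ = _ := by ring
  have hcl : (A, B) ∈ closure (Ioo A (f x) ×ˢ Ioo (f y) B) := by
    rw [closure_prod_eq, closure_Ioo hfx.1.ne, closure_Ioo hfy.2.ne]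
    exact ⟨left_mem_Icc.2 hfx.1.le, right_mem_Icc.2 hfy.2.le⟩
  exact ContinuousWithinAt.closure_le (f := fun z : ℝ × ℝ => (y - x) * ((f x - z.1) * (z.2 - f y)))
    (g := fun z => (f y - f x) * (z.2 - z.1) * (x - lo)) hcl (by fun_prop) (by fun_prop) key

/-- Pull-back of a diffeomorphism `k` by a one-sided branch of `z ↦ h (z ^ 2)`. -/
theorem exists_pullback_sq {h k : ℝ → ℝ} {K D : Set ℝ} {w r y : ℝ}
    (hh : CrossRatioExpanding h J K) (hk : CrossRatioExpanding k D I) (hD : D ⊆ K)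
    (hw : 0 ≤ w) (hwJ : w ∈ J → h w ∉ D) (hrJ : r ^ 2 ∈ J → h (r ^ 2) ∉ D)
    (hwy : w ≤ y ^ 2) (hyr : y ^ 2 < r ^ 2) (hyJ : y ^ 2 ∈ J) (hyD : h (y ^ 2) ∈ D) :
    ∃ D₁, CrossRatioExpanding (fun z => k (h (z ^ 2))) D₁ I ∧ y ∈ D₁ ∧
      ∀ z ∈ D₁, w < z ^ 2 ∧ z ^ 2 < r ^ 2 ∧ h (z ^ 2) ∈ D := by
  have hc := hk.comp hh hD
  set J₂ := J ∩ h ⁻¹' D with hJ₂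
  have hyJ₂ : y ^ 2 ∈ J₂ := ⟨hyJ, hyD⟩
  have hwJ₂ : w ∉ J₂ := fun hx => hwJ hx.1 hx.2
  have hrJ₂ : r ^ 2 ∉ J₂ := fun hx => hrJ hx.1 hx.2
  have hlow : ∀ t ∈ J₂, w < t := fun t ht => by
    by_contra! hcon
    exact hwJ₂ (hc.ordConnected.out ht hyJ₂ ⟨hcon, hwy⟩)
  have hupp : ∀ t ∈ J₂, t < r ^ 2 := fun t ht => by
    by_contra! hcon
    exact hrJ₂ (hc.ordConnected.out hyJ₂ ht ⟨hyr.le, hcon⟩)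
  have hsub : J₂ ⊆ Ioi 0 := fun t ht => hw.trans_lt (hlow t ht)
  have hy0 : y ≠ 0 := by
    rintro rfl
    have := hlow _ hyJ₂
    simp at this
    linarith
  rcases lt_or_gt_of_ne hy0 with hy | hy
  · exact ⟨_, hc.comp sq_Iio hsub, ⟨hy, hyJ₂⟩, fun z hz => ⟨hlow _ hz.2, hupp _ hz.2, hz.2.2⟩⟩
  · exact ⟨_, hc.comp sq_Ioi hsub, ⟨hy, hyJ₂⟩, fun z hz => ⟨hlow _ hz.2, hupp _ hz.2, hz.2.2⟩⟩

end CrossRatioExpanding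

theorem mem_Ioo_neg_iff_abs_lt {x a : ℝ} : x ∈ Ioo (-a) a ↔ |x| < a := abs_lt.symm

theorem eq_of_Ioo_neg_eq {a b : ℝ} (hb : 0 < b) (h : Ioo (-a) a = Ioo (-b) b) : a = b := by
  have ha : 0 < a := by
    have : (0 : ℝ) ∈ Ioo (-a) a := by rw [h]; exact ⟨by linarith, hb⟩
    exact this.2
  apply le_antisymm
  · exact ((Ioo_subset_Ioo_iff (by linarith)).1 h.le).2
  · exact ((Ioo_subset_Ioo_iff (by linarith)).1 h.ge).2

theorem sign_mul_mul {σ : ℝ} (hσ : σ = 1 ∨ σ = -1) (x : ℝ) : σ * (σ * x) = x := by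
  rcases hσ with rfl | rfl <;> ring

theorem abs_sign_mul {σ : ℝ} (hσ : σ = 1 ∨ σ = -1) (x : ℝ) : |σ * x| = |x| := by
  rcases hσ with rfl | rfl <;> simp

theorem CrossRatioExpanding.sign_mul {f : ℝ → ℝ} {J : Set ℝ} {X σ : ℝ}
    (hf : CrossRatioExpanding f J (Ioo (-X) X)) (hσ : σ = 1 ∨ σ = -1) :
    CrossRatioExpanding (fun t => σ * f t) J (Ioo (-X) X) := by
  have := (CrossRatioExpanding.mul_sign hσ (ordConnected_Ioo (a := -X) (b := X))
    (fun x => by simp only [mem_Ioo_neg_iff_abs_lt, abs_sign_mul hσ])).comp hf subset_rfl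
  rwa [inter_eq_left.2 (show J ⊆ f ⁻¹' Ioo (-X) X from hf.bijOn.mapsTo)] at this

/-! ### Normal form of box mappings with extendable branches -/

namespace BoxMap

/-- The central branch of `φ` is `x ↦ σ * H (x ^ 2)`, where `σ = ± 1` and the increasing map `H`
expands cross-ratios and has range `(-X, X)`. -/
structure Central (φ : BoxMap) (σ X : ℝ) (H : ℝ → ℝ) (J : Set ℝ) : Prop where
  sign : σ = 1 ∨ σ = -1
  inner_pos : 0 < φ.inner
  inner_lt_outer : φ.inner < φ.outer
  outer_le : φ.outer ≤ X
  expanding : CrossRatioExpanding H J (Ioo (-X) X)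
  mono : StrictMonoOn H J
  eq : ∀ x, |x| < φ.inner → x ^ 2 ∈ J ∧ φ.toFun x = σ * H (x ^ 2)
  lt_iff : ∀ t ∈ J, t < φ.inner ^ 2 ↔ H t < φ.outer

/-- The point `x` lies in a branch of `φ` that is mapped onto the central box and extends to a
cross-ratio expanding map onto `(-Q, Q)`. -/
def HasBranch (φ : BoxMap) (Q x : ℝ) : Prop :=
  ∃ (g : ℝ → ℝ) (D : Set ℝ), CrossRatioExpanding g D (Ioo (-Q) Q) ∧ x ∈ D ∧ |g x| < φ.inner ∧
    ∀ z ∈ D, |z| < φ.outer ∧ φ.inner ≤ |z| ∧ (|g z| < φ.inner → z ∈ φ.dom ∧ φ.toFun z = g z) ∧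
      (|g z| = φ.inner → z ∉ φ.dom)

/-- The domain of `φ` has the central box as a component, and all its other branches are
extendable over `(-Q, Q)`. -/
structure HasBranches (φ : BoxMap) (Q : ℝ) : Prop where
  innerBox_subset : φ.innerBox ⊆ φ.dom
  inner_notMem : ∀ x, |x| = φ.inner → x ∉ φ.dom
  branch : ∀ x ∈ φ.dom \ φ.innerBox, φ.HasBranch Q x

theorem mem_innerBox {φ : BoxMap} {x : ℝ} : x ∈ φ.innerBox ↔ |x| < φ.inner :=
  mem_Ioo_neg_iff_abs_lt

theorem mem_outerBox {φ : BoxMap} {x : ℝ} : x ∈ φ.outerBox ↔ |x| < φ.outer :=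
  mem_Ioo_neg_iff_abs_lt

end BoxMap

/-! ### Filling-in and the step for non-close returns -/

/-- The branches of a first entry map. -/
theorem exists_entry_branch {F : ℝ → ℝ} {S b V : Set ℝ} {ρ Q : ℝ} (hρ : ρ ≤ Q)
    (hbr : ∀ x ∈ S \ b, |x| < ρ → ∃ (g : ℝ → ℝ) (D : Set ℝ),
      CrossRatioExpanding g D (Ioo (-Q) Q) ∧ x ∈ D ∧ |g x| < ρ ∧
      ∀ z ∈ D, |z| < ρ ∧ z ∉ b ∧ (x ∈ V → z ∈ V) ∧ (|g z| < ρ → z ∈ S ∧ F z = g z))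
    (j : ℕ) : ∀ x, |x| < ρ → (∀ i < j + 1, F^[i] x ∈ S \ b) → ∃ (g : ℝ → ℝ) (D : Set ℝ),
      CrossRatioExpanding g D (Ioo (-Q) Q) ∧ x ∈ D ∧ |g x| < ρ ∧
      ∀ z ∈ D, |z| < ρ ∧ z ∉ b ∧ (x ∈ V → z ∈ V) ∧
        (|g z| < ρ → (∀ i < j + 1, F^[i] z ∈ S \ b) ∧ F^[j + 1] z = g z) := by
  induction j with
  | zero =>
    intro x hx hS
    obtain ⟨g, D, hg, hxD, hgx, hD⟩ := hbr x (hS 0 (by omega)) hx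
    refine ⟨g, D, hg, hxD, hgx, fun z hz => ?_⟩
    obtain ⟨h1, h2, h3, h4⟩ := hD z hz
    refine ⟨h1, h2, h3, fun h => ⟨fun i hi => ?_, (h4 h).2⟩⟩
    obtain rfl : i = 0 := by omega
    exact ⟨(h4 h).1, h2⟩
  | succ j ih =>
    intro x hx hS
    obtain ⟨p, D₁, hp, hxD₁, hpx, hD₁⟩ := hbr x (hS 0 (by omega)) hx
    have hFx : F x = p x := ((hD₁ x hxD₁).2.2.2 hpx).2
    obtain ⟨g, D₂, hg, hxD₂, hgx, hD₂⟩ := ih (p x) hpx fun i hi => by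
      rw [← hFx, ← Function.iterate_succ_apply]
      exact hS (i + 1) (by omega)
    have hsub : D₂ ⊆ Ioo (-Q) Q := fun z hz => by
      rw [mem_Ioo_neg_iff_abs_lt]
      exact (hD₂ z hz).1.trans_le hρ
    refine ⟨_, _, hg.comp hp hsub, ⟨hxD₁, hxD₂⟩, hgx, fun z hz => ?_⟩
    obtain ⟨h1, h2, h3, h4⟩ := hD₁ z hz.1
    obtain ⟨k1, k2, k3, k4⟩ := hD₂ (p z) hz.2
    have hFz := h4 k1
    refine ⟨h1, h2, h3, fun h => ⟨fun i hi => ?_, ?_⟩⟩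
    · rcases i with _ | i
      · exact ⟨hFz.1, h2⟩
      · rw [Function.iterate_succ_apply, hFz.2]
        exact (k4 h).1 i (by omega)
    · rw [Function.iterate_succ_apply, hFz.2]
      exact (k4 h).2

namespace BoxMap

/-- Branches compose along an orbit because each domain lies in `(-ρ, ρ) ⊆ (-Q, Q)`. A point whose
image is an endpoint of the central box is stopped there, outside `S`, before any entry, so it is
not in the domain. The radius `ρ` may exceed `ψ.outer`: after a close return an orbit can leave the
outer box before its first entry. -/
theorem IsFilling.hasBranches {ψ : BoxMap} {central F : ℝ → ℝ} {S : Set ℝ} {ρ Q : ℝ}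
    (hψ : ψ.IsFilling central F S) (hρ : ρ ≤ Q) (hin : ψ.inner < ρ)
    (hout : ψ.outer ≤ ρ) (hS : ∀ x, |x| = ψ.inner → x ∉ S)
    (hbr : ∀ x ∈ S \ ψ.innerBox, |x| < ρ → ∃ (g : ℝ → ℝ) (D : Set ℝ),
      CrossRatioExpanding g D (Ioo (-Q) Q) ∧ x ∈ D ∧ |g x| < ρ ∧
      ∀ z ∈ D, |z| < ρ ∧ z ∉ ψ.innerBox ∧ (x ∈ ψ.outerBox → z ∈ ψ.outerBox) ∧
        (|g z| < ρ → z ∈ S ∧ F z = g z)) :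
    ψ.HasBranches Q where
  innerBox_subset := by
    rw [hψ.dom_eq]
    exact subset_union_left
  inner_notMem := by
    intro x hx hdom
    rw [hψ.dom_eq] at hdom
    rcases hdom with h | ⟨-, y, j, hj, hlt, -⟩
    · rw [mem_innerBox] at h
      exact h.ne hx
    · exact hS x hx (hlt 0 (by omega)).1
  branch := by
    rintro x ⟨hdom, hxin⟩
    rw [hψ.dom_eq] at hdom
    rcases hdom with h | ⟨hxout, y, j, hj, hlt, hmem, -⟩
    · exact absurd h hxin
    obtain ⟨j, rfl⟩ : ∃ i, j = i + 1 := ⟨j - 1, by omega⟩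
    have hxρ : |x| < ρ := (mem_outerBox.1 hxout).trans_le hout
    obtain ⟨g, D, hg, hxD, hgx, hD⟩ := exists_entry_branch hρ hbr j x hxρ hlt
    refine ⟨g, D, hg, hxD, ?_, fun z hz => ?_⟩
    · rw [← ((hD x hxD).2.2.2 hgx).2]
      exact mem_innerBox.1 hmem
    · obtain ⟨h1, h2, h3, h4⟩ := hD z hz
      have hzout := h3 hxout
      refine ⟨mem_outerBox.1 hzout, not_lt.1 fun h => h2 (mem_innerBox.2 h), fun h => ?_,
        fun h hdom => ?_⟩
      · obtain ⟨k1, k2⟩ := h4 (h.trans hin)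
        have he : FirstEntry F S ψ.innerBox z (g z) :=
          ⟨j + 1, by omega, k1, by rw [k2]; exact mem_innerBox.2 h, k2.symm⟩
        refine ⟨?_, hψ.eq_entry z hzout _ he⟩
        rw [hψ.dom_eq]
        exact Or.inr ⟨hzout, _, he⟩
      · obtain ⟨k1, k2⟩ := h4 (h.trans_lt hin)
        rw [hψ.dom_eq] at hdom
        rcases hdom with h' | ⟨-, y', j', hj', hlt', hmem', -⟩
        · exact h2 h'
        rcases lt_trichotomy j' (j + 1) with hlt2 | rfl | hgt
        · exact (k1 j' hlt2).2 hmem'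
        · rw [k2, mem_innerBox] at hmem'
          exact hmem'.ne h
        · have := (hlt' _ hgt).1
          rw [k2] at this
          exact hS _ h this

/-- The metric information on a step for non-close returns: the boxes are `(-v, v) ⊆ (-u, u)`
and the new central box is `(-s, s)`. Up to sign `c` and `k` are the old and the new critical value,
`E` is the image of the boundary of the new central box. The central branch is extendable over
`(-X, X)`, and the branch at the critical value over `(-Q, Q)`. -/
structure StepEstimate (u v X Q s c E k : ℝ) : Prop where
  s_pos : 0 < s
  s_lt : s < v
  neg_lt_c : -u < c
  c_lt : c < E
  E_lt : E < u
  abs_k_lt : |k| < v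
  side : v ≤ c ∨ E ≤ -v
  fold : s ^ 2 * ((c + X) * (u - E)) ≤ (E - c) * (u + X) * (v ^ 2 - s ^ 2)
  right : (E - c) * ((k + Q) * (Q - v)) ≤ (v - k) * (2 * Q) * (u - E)
  left : (E - c) * ((k + Q) * (Q - v)) ≤ (v - k) * (2 * Q) * (c + u)

variable {φ ψ χ : BoxMap} {σ X Q : ℝ} {H : ℝ → ℝ} {J : Set ℝ}

theorem Central.zero_mem (hc : φ.Central σ X H J) : (0 : ℝ) ∈ J := by
  simpa using (hc.eq 0 (by simpa using hc.inner_pos)).1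

theorem Central.apply_zero (hc : φ.Central σ X H J) : φ.toFun 0 = σ * H 0 := by
  simpa using (hc.eq 0 (by simpa using hc.inner_pos)).2

theorem Central.outer_le_of_inner_sq_mem (hc : φ.Central σ X H J) (h : φ.inner ^ 2 ∈ J) :
    φ.outer ≤ |σ * H (φ.inner ^ 2)| := by
  rw [abs_sign_mul hc.sign]
  have := mt (hc.lt_iff _ h).2 (lt_irrefl _)
  exact (not_lt.1 this).trans (le_abs_self _)

/-- The parent branches of `φ` away from the new central box `(-√e, √e)`. -/
theorem Central.exists_parent_branch (hc : φ.Central σ X H J) (hb : φ.HasBranches Q)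
    (hQ : φ.inner < Q) {e : ℝ} (he : 0 ≤ e) (hedom : e ∈ J → σ * H e ∉ φ.dom)
    {x : ℝ} (hx : x ∈ φ.parentDom) (hex : e ≤ x ^ 2) :
    ∃ (g : ℝ → ℝ) (D : Set ℝ), CrossRatioExpanding g D (Ioo (-φ.inner) φ.inner) ∧ x ∈ D ∧
      ∀ z ∈ D, e < z ^ 2 ∧ z ∈ φ.parentDom ∧ φ.parentMap z = g z := by
  obtain ⟨hxB, hxdom⟩ := hx
  have hxB' := mem_innerBox.1 hxB
  obtain ⟨k, D, hk, hxD, hDout, hDdom, hDmap⟩ : ∃ (k : ℝ → ℝ) (D : Set ℝ),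
      CrossRatioExpanding k D (Ioo (-φ.inner) φ.inner) ∧ φ.toFun x ∈ D ∧
      (∀ z ∈ D, |z| < φ.outer) ∧ D ⊆ φ.dom ∧
      ∀ z, φ.toFun z ∈ D → φ.parentMap z = k (φ.toFun z) := by
    by_cases hy : φ.toFun x ∈ φ.innerBox
    · refine ⟨fun t => t, Ioo (-φ.inner) φ.inner, CrossRatioExpanding.id ordConnected_Ioo, hy,
        fun z hz => (mem_innerBox.1 hz).trans hc.inner_lt_outer, hb.innerBox_subset,
        fun z hz => ?_⟩
      rw [parentMap]
      exact if_pos hz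
    · obtain ⟨g, D, hg, hyD, hgy, hD⟩ := hb.branch _ ⟨hxdom, hy⟩
      refine ⟨g, D ∩ g ⁻¹' Ioo (-φ.inner) φ.inner, hg.restrict ordConnected_Ioo
        (Ioo_subset_Ioo (by linarith) hQ.le), ⟨hyD, mem_innerBox.2 hgy⟩,
        fun z hz => (hD z hz.1).1, fun z hz => ((hD z hz.1).2.2.1 (mem_innerBox.1 hz.2)).1,
        fun z hz => ?_⟩
      obtain ⟨-, h2, h3, -⟩ := hD _ hz.1
      rw [parentMap, if_neg fun h => (mem_innerBox.1 h).not_ge h2,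
        (h3 (mem_innerBox.1 hz.2)).2]
  obtain ⟨hxJ, hφx⟩ := hc.eq x hxB'
  obtain ⟨D₁, hD₁, hxD₁, hz⟩ := (hc.expanding.sign_mul hc.sign).exists_pullback_sq hk
    (fun z hz => mem_Ioo_neg_iff_abs_lt.2 ((hDout z hz).trans_le hc.outer_le)) he
    (fun h1 h2 => hedom h1 (hDdom h2))
    (fun h1 h2 => (hDout _ h2).not_ge (hc.outer_le_of_inner_sq_mem h1)) hex
    (sq_lt_sq' (by linarith [(abs_lt.1 hxB').1]) (abs_lt.1 hxB').2) hxJ (hφx ▸ hxD)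
  refine ⟨_, D₁, hD₁, hxD₁, fun z hzD => ?_⟩
  obtain ⟨h1, h2, h3⟩ := hz z hzD
  have hzB : |z| < φ.inner := abs_lt_of_sq_lt_sq h2 hc.inner_pos.le
  have hφz := (hc.eq z hzB).2
  rw [← hφz] at h3 ⊢
  exact ⟨h1, ⟨mem_innerBox.2 hzB, hDdom h3⟩, hDmap z h3⟩

/-- The new central branch is the old one followed by the monotone branch at the critical value, so
it inherits the range `(-Q, Q)` of that branch. The parent branches map onto the old central box,
which is the new outer box, hence filled-in branches extend over it. -/
theorem IsNonCloseStep.exists_central (hstep : IsNonCloseStep φ ψ) (hc : φ.Central σ X H J)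
    (hb : φ.HasBranches Q) (hQ : φ.outer ≤ Q) :
    ∃ (σ' : ℝ) (H' : ℝ → ℝ) (J' : Set ℝ) (E : ℝ), ψ.Central σ' Q H' J' ∧
      ψ.HasBranches ψ.outer ∧
      StepEstimate φ.outer φ.inner X Q ψ.inner (H 0) E (H' 0) := by
  have hv := hc.inner_pos
  have hvu := hc.inner_lt_outer
  have hvQ : φ.inner < Q := hvu.trans_le hQ
  have h0J := hc.zero_mem
  obtain ⟨g, D, hg, hcD, hgc, hD⟩ := hb.branch _ hstep.nonClose
  -- the branch at the critical value, normalised to be increasing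
  have hg0 := hg.comp (CrossRatioExpanding.mul_sign hc.sign ordConnected_univ (by simp))
    (subset_univ _)
  rw [univ_inter] at hg0
  set D' := (fun x => σ * x) ⁻¹' D with hD'
  obtain ⟨σ', hσ', hGmono⟩ : ∃ σ' : ℝ, (σ' = 1 ∨ σ' = -1) ∧
      StrictMonoOn (fun x => σ' * g (σ * x)) D' := by
    rcases hg0.strict with h | h
    · exact ⟨1, Or.inl rfl, by simpa using h⟩
    · exact ⟨-1, Or.inr rfl, fun a ha b hb' hab => by
        have := h ha hb' hab
        simp only at this ⊢
        linarith⟩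
  have hG := hg0.sign_mul hσ'
  set G : ℝ → ℝ := fun x => σ' * g (σ * x) with hGdef
  have absG : ∀ x, |G x| = |g (σ * x)| := fun x => abs_sign_mul hσ' _
  have hD'abs : ∀ z ∈ D', |z| < φ.outer ∧ φ.inner ≤ |z| := fun z hz => by
    have := hD _ hz
    rw [abs_sign_mul hc.sign] at this
    exact ⟨this.1, this.2.1⟩
  have hD'X : D' ⊆ Ioo (-X) X := fun z hz =>
    mem_Ioo_neg_iff_abs_lt.2 ((hD'abs z hz).1.trans_le hc.outer_le)
  rw [hc.apply_zero] at hcD hgc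
  have hcD' : H 0 ∈ D' := hcD
  have hGc : |G (H 0)| < φ.inner := by rwa [absG]
  -- the boundary of the new central box
  obtain ⟨E, hED', hGE⟩ := hG.bijOn.surjOn
    (mem_Ioo_neg_iff_abs_lt.2 (by rwa [abs_of_pos hv]) : φ.inner ∈ Ioo (-Q) Q)
  obtain ⟨e, heJ, rfl⟩ := hc.expanding.bijOn.surjOn (hD'X hED')
  have hcE : H 0 < H e := (hGmono.lt_iff_lt hcD' hED').1 (by rw [hGE]; exact (abs_lt.1 hGc).2)
  have he0 : 0 < e := (hc.mono.lt_iff_lt h0J heJ).1 hcE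
  have hEu : H e < φ.outer := (abs_lt.1 (hD'abs _ hED').1).2
  have hev : e < φ.inner ^ 2 := (hc.lt_iff e heJ).2 hEu
  set s := √e with hs
  have hs0 : 0 < s := Real.sqrt_pos.2 he0
  have hse : s ^ 2 = e := Real.sq_sqrt he0.le
  have hsv : s < φ.inner := lt_of_pow_lt_pow_left₀ 2 hv.le (by rwa [hse])
  have hEdom : σ * H e ∉ φ.dom := (hD _ hED').2.2.2 (by rw [← absG, hGE, abs_of_pos hv])
  have hsq : ∀ x, |x| < s → x ^ 2 < e := fun x hx => by
    rw [← hse]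
    exact sq_lt_sq' (by linarith [(abs_lt.1 hx).1]) (abs_lt.1 hx).2
  -- the new central branch
  have hcore : ∀ t ∈ Ico 0 e, t ∈ J ∧ H t ∈ D' ∧ |G (H t)| < φ.inner := by
    intro t ht
    have htJ : t ∈ J := hc.expanding.ordConnected.out h0J heJ ⟨ht.1, ht.2.le⟩
    have h1 : H 0 ≤ H t := hc.mono.monotoneOn h0J htJ ht.1
    have h2 : H t < H e := hc.mono htJ heJ ht.2
    have htD : H t ∈ D' := hG.ordConnected.out hcD' hED' ⟨h1, h2.le⟩
    refine ⟨htJ, htD, abs_lt.2 ⟨(abs_lt.1 hGc).1.trans_le (hGmono.monotoneOn hcD' htD h1), ?_⟩⟩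
    rw [← hGE]
    exact hGmono htD hED' h2
  have hnew : ∀ x, |x| < s → x ∈ φ.parentDom ∧ φ.parentMap x = σ' * G (H (x ^ 2)) := by
    intro x hx
    obtain ⟨h1, h2, h3⟩ := hcore (x ^ 2) ⟨sq_nonneg x, hsq x hx⟩
    have hxv := hx.trans hsv
    have hφx := (hc.eq x hxv).2
    have hD2 := hD _ h2
    rw [absG] at h3
    obtain ⟨k1, k2⟩ := hD2.2.2.1 h3
    refine ⟨⟨mem_innerBox.2 hxv, by rwa [hφx]⟩, ?_⟩
    rw [parentMap, hφx, if_neg fun h => (mem_innerBox.1 h).not_ge hD2.2.1, k2, hGdef,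
      sign_mul_mul hσ']
  have hends : ∀ x, |x| = s → x ∉ φ.parentDom := by
    rintro x hx ⟨-, h⟩
    have hx2 : x ^ 2 = e := by rw [← sq_abs, hx, hse]
    rw [(hc.eq x (by rwa [hx])).2, hx2] at h
    exact hEdom h
  have hcomp : connectedComponentIn φ.parentDom 0 = Ioo (-s) s := by
    have h0 : (0 : ℝ) ∈ Ioo (-s) s := ⟨by linarith, hs0⟩
    have hsub : Ioo (-s) s ⊆ φ.parentDom := fun x hx =>
      (hnew x (mem_Ioo_neg_iff_abs_lt.1 hx)).1
    refine Subset.antisymm (fun x hx => ?_) (isPreconnected_Ioo.subset_connectedComponentIn h0 hsub)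
    have hoc : (connectedComponentIn φ.parentDom 0).OrdConnected :=
      isPreconnected_connectedComponentIn.ordConnected
    have h0C : (0 : ℝ) ∈ connectedComponentIn φ.parentDom 0 := mem_connectedComponentIn (hsub h0)
    refine ⟨?_, ?_⟩ <;> by_contra! hcon
    · exact hends (-s) (by rw [abs_neg, abs_of_pos hs0])
        (connectedComponentIn_subset _ _ (hoc.out hx h0C ⟨hcon, by linarith⟩))
    · exact hends s (abs_of_pos hs0)
        (connectedComponentIn_subset _ _ (hoc.out h0C hx ⟨hs0.le, hcon⟩))
  have hinner : ψ.inner = s := eq_of_Ioo_neg_eq hs0 (hstep.innerBox_eq.trans hcomp)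
  have houter := hstep.outer_eq
  have hH' := hG.comp hc.expanding hD'X
  refine ⟨σ', fun t => G (H t), J ∩ H ⁻¹' D', H e, ?_, ?_, ?_⟩
  · refine ⟨hσ', by rwa [hinner], by rwa [hinner, houter], by rw [houter]; exact hvQ.le, hH',
      fun a ha b hb' hab => hGmono ha.2 hb'.2 (hc.mono ha.1 hb'.1 hab), fun x hx => ?_, ?_⟩
    · rw [hinner] at hx
      obtain ⟨h1, h2, -⟩ := hcore (x ^ 2) ⟨sq_nonneg x, hsq x hx⟩
      refine ⟨⟨h1, h2⟩, ?_⟩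
      rw [← (hnew x hx).2]
      exact hstep.filling.eq_central (mem_innerBox.2 (by rwa [hinner]))
    · intro t ht
      rw [hinner, houter, hse, ← hGE, hGmono.lt_iff_lt ht.2 hED', hc.mono.lt_iff_lt ht.1 heJ]
  · refine hstep.filling.hasBranches (ρ := φ.inner) (by rw [houter]) (by rwa [hinner])
      houter.le (fun x hx => hends x (by rw [hx, hinner])) ?_
    rintro x ⟨hxP, hxB⟩ -
    have hex : e ≤ x ^ 2 := by
      rw [mem_innerBox, hinner, not_lt] at hxB
      rw [← hse, ← sq_abs x]
      exact pow_le_pow_left₀ hs0.le hxB 2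
    obtain ⟨k, D₁, hk, hxD, hz⟩ := hc.exists_parent_branch hb hvQ he0.le (fun _ => hEdom) hxP hex
    rw [houter]
    refine ⟨k, D₁, hk, hxD, mem_Ioo_neg_iff_abs_lt.1 (hk.bijOn.mapsTo hxD), fun z hzD => ?_⟩
    obtain ⟨h1, h2, h3⟩ := hz z hzD
    have hzv := mem_innerBox.1 h2.1
    refine ⟨hzv, fun h => ?_, fun _ => mem_outerBox.2 (by rwa [houter]), fun _ => ⟨h2, h3⟩⟩
    rw [mem_innerBox, hinner] at h
    exact (hsq z h).not_gt h1
  · have hcu := (hD'abs _ hcD').1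
    rw [hinner]
    refine ⟨hs0, hsv, (abs_lt.1 hcu).1, hcE, hEu, hGc, ?_, ?_, ?_, ?_⟩
    · rcases le_or_gt φ.inner (H 0) with h | h
      · exact Or.inl h
      right
      have hc1 : H 0 ≤ -φ.inner := by
        rcases le_abs.1 (hD'abs _ hcD').2 with h' | h' <;> linarith
      -- If `H 0` and `H e` had opposite signs, the interval `D'` would contain `0`.
      rcases le_abs.1 (hD'abs _ hED').2 with h' | h'
      · have := (hD'abs 0 (hG.ordConnected.out hcD' hED' ⟨by linarith, by linarith⟩)).2
        rw [abs_zero] at this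
        linarith
      · linarith
    -- Cutting the range at `φ.outer` makes `φ.inner ^ 2` an upper bound of the domain.
    · have hr := hc.expanding.restrict (ordConnected_Ioo (a := -X) (b := φ.outer))
        (Ioo_subset_Ioo le_rfl hc.outer_le)
      have := hr.le_right (hi := φ.inner ^ 2) (hc.mono.mono inter_subset_left)
        (fun t ht => ((hc.lt_iff t ht.1).2 ht.2.2).le) (x := 0) (y := e)
        ⟨h0J, (hD'X hcD').1, (abs_lt.1 hcu).2⟩ ⟨heJ, (hD'X hED').1, hEu⟩ he0
      rw [hse]
      simpa only [sub_zero, sub_neg_eq_add] using this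
    · have := hG.le_right (hi := φ.outer) hGmono (fun t ht => (abs_lt.1 (hD'abs t ht).1).2.le)
        hcD' hED' hcE
      rw [hGE] at this
      linarith
    · have := hG.le_left (lo := -φ.outer) hGmono (fun t ht => (abs_lt.1 (hD'abs t ht).1).1.le)
        hcD' hED' hcE
      rw [hGE] at this
      linarith

end BoxMap

/-! ### First stage of the step for close returns -/

namespace BoxMap

variable {φ ψ χ : BoxMap} {σ X Q : ℝ} {H : ℝ → ℝ} {J : Set ℝ} {l : ℕ}

theorem mem_centralPreimage_succ {m : ℕ} {x : ℝ} :
    x ∈ φ.centralPreimage (m + 1) ↔ x ∈ φ.innerBox ∧ φ.toFun x ∈ φ.centralPreimage m := by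
  constructor
  · refine fun h => ⟨h 0 (by omega), fun j hj => ?_⟩
    rw [← Function.iterate_succ_apply]
    exact h (j + 1) (by omega)
  · rintro ⟨h1, h2⟩ (_ | j) hj
    · exact h1
    · rw [Function.iterate_succ_apply]
      exact h2 j (by omega)

theorem Central.continuousAt (hc : φ.Central σ X H J) {x : ℝ} (hx : |x| < φ.inner) :
    ContinuousAt φ.toFun x := by
  have h : ContinuousOn φ.toFun φ.innerBox := by
    refine ContinuousOn.congr (f := fun x => σ * H (x ^ 2)) ?_
      fun y hy => (hc.eq y (mem_innerBox.1 hy)).2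
    exact continuousOn_const.mul (hc.expanding.continuousOn.comp (by fun_prop)
      fun y hy => (hc.eq y (mem_innerBox.1 hy)).1)
  exact h.continuousAt (isOpen_Ioo.mem_nhds (mem_innerBox.2 hx))

theorem Central.continuousAt_iterate (hc : φ.Central σ X H J) {x : ℝ} (i : ℕ)
    (hx : ∀ j < i, φ.toFun^[j] x ∈ φ.innerBox) : ContinuousAt φ.toFun^[i] x := by
  induction i with
  | zero => exact continuousAt_id
  | succ i ih =>
    rw [Function.iterate_succ']
    exact ContinuousAt.comp (hc.continuousAt (mem_innerBox.1 (hx i (by omega))))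
      (ih fun j hj => hx j (by omega))

/-- Boundary points of the preimages of the central box do not escape into the domain. -/
theorem Central.notMem_escapeDom (hc : φ.Central σ X H J)
    (hr : ∀ x, |x| = φ.inner → x ∉ φ.dom) {m : ℕ} {x : ℝ}
    (hx : x ∈ closure (φ.centralPreimage m)) : x ∉ φ.escapeDom m := by
  rintro ⟨i, him, hlt, hdom, hB⟩
  have hle : |φ.toFun^[i] x| ≤ φ.inner :=
    ContinuousWithinAt.closure_le hx (hc.continuousAt_iterate i hlt).abs.continuousWithinAt
      continuousWithinAt_const fun y hy => (mem_innerBox.1 (hy i him)).le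
  exact hr _ (le_antisymm hle (not_lt.1 fun h => hB (mem_innerBox.2 h))) hdom

/-- The branches of the escape map. -/
theorem Central.exists_escape_branch (hc : φ.Central σ X H J) (hb : φ.HasBranches φ.outer)
    (h0 : φ.toFun 0 ∈ φ.centralPreimage l) (i : ℕ) : i ≤ l + 1 → ∀ x,
    (∀ j < i, φ.toFun^[j] x ∈ φ.innerBox) → φ.toFun^[i] x ∈ φ.dom \ φ.innerBox →
    ∃ (g : ℝ → ℝ) (D : Set ℝ), CrossRatioExpanding g D (Ioo (-φ.outer) φ.outer) ∧ x ∈ D ∧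
      |g x| < φ.inner ∧ ∀ z ∈ D, |z| < φ.outer ∧ (∀ j < i, φ.toFun^[j] z ∈ φ.innerBox) ∧
        φ.toFun^[i] z ∉ φ.innerBox ∧
        (|g z| < φ.inner → φ.toFun^[i] z ∈ φ.dom ∧ φ.toFun^[i + 1] z = g z) := by
  induction i with
  | zero =>
    intro _ x _ hx
    obtain ⟨g, D, hg, hxD, hgx, hD⟩ := hb.branch x hx
    refine ⟨g, D, hg, hxD, hgx, fun z hz => ?_⟩
    obtain ⟨h1, h2, h3, -⟩ := hD z hz
    exact ⟨h1, fun j hj => by omega, fun h => (mem_innerBox.1 h).not_ge h2, h3⟩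
  | succ i ih =>
    intro hi x hlt hx
    have hxB : |x| < φ.inner := mem_innerBox.1 (hlt 0 (by omega))
    obtain ⟨g, D, hg, hyD, hgy, hD⟩ := ih (by omega) (φ.toFun x)
      (fun j hj => by
        rw [← Function.iterate_succ_apply]
        exact hlt (j + 1) (by omega))
      (by rwa [← Function.iterate_succ_apply])
    obtain ⟨hxJ, hφx⟩ := hc.eq x hxB
    -- The critical value is still in the central box at the time when points of `D` have escaped,
    -- so the pull-back of `D` misses `0`, where squaring folds.
    have hcD : σ * H 0 ∉ D := fun h => by
      rw [← hc.apply_zero] at h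
      exact (hD _ h).2.2.1 (h0 i (by omega))
    obtain ⟨D₁, hD₁, hxD₁, hz⟩ := (hc.expanding.sign_mul hc.sign).exists_pullback_sq hg
      (fun z hz => mem_Ioo_neg_iff_abs_lt.2 ((hD z hz).1.trans_le hc.outer_le)) le_rfl
      (fun _ => hcD)
      (fun h1 h2 => (hD _ h2).1.not_ge (hc.outer_le_of_inner_sq_mem h1)) (sq_nonneg x)
      (sq_lt_sq' (by linarith [(abs_lt.1 hxB).1]) (abs_lt.1 hxB).2) hxJ (hφx ▸ hyD)
    refine ⟨_, D₁, hD₁, hxD₁, by rwa [← hφx], fun z hzD => ?_⟩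
    obtain ⟨-, h2, h3⟩ := hz z hzD
    have hzB : |z| < φ.inner := abs_lt_of_sq_lt_sq h2 hc.inner_pos.le
    rw [← (hc.eq z hzB).2] at h3 ⊢
    obtain ⟨k1, k2, k3, k4⟩ := hD _ h3
    refine ⟨hzB.trans hc.inner_lt_outer, fun j hj => ?_, k3, k4⟩
    rcases j with _ | j
    · exact mem_innerBox.2 hzB
    · rw [Function.iterate_succ_apply]
      exact k2 j (by omega)

theorem escapeMap_eq {i : ℕ} {z : ℝ} (hlt : ∀ j < i, φ.toFun^[j] z ∈ φ.innerBox)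
    (hi : φ.toFun^[i] z ∉ φ.innerBox) : φ.escapeMap z = φ.toFun^[i + 1] z := by
  have : sInf {i : ℕ | φ.toFun^[i] z ∉ φ.innerBox} = i := by
    refine le_antisymm (Nat.sInf_le hi) (le_csInf ⟨i, hi⟩ fun j hj => ?_)
    by_contra! hcon
    exact hj (hlt j hcon)
  rw [escapeMap, this]

/-- The central branch is merely restricted, so its extension is unchanged. Escape branches are
pull-backs of monotone branches by the central branch and keep the range `φ.outerBox`. -/
theorem IsCloseStage.exists_central (hstage : IsCloseStage φ l χ) (hc : φ.Central σ X H J)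
    (hb : φ.HasBranches φ.outer) :
    χ.Central σ X H J ∧ χ.HasBranches φ.outer ∧ χ.outer ≤ φ.inner ∧ χ.inner ≤ |H 0| := by
  have hr := hc.inner_pos
  have hrR := hc.inner_lt_outer
  have hcl := hstage.close
  have h0mem : (0 : ℝ) ∈ χ.innerBox := by
    rw [hstage.innerBox_eq, mem_centralPreimage_succ]
    exact ⟨mem_innerBox.2 (by simpa using hr), hcl⟩
  have hv0 : 0 < χ.inner := by simpa using mem_innerBox.1 h0mem
  have hcu : |φ.toFun 0| < χ.outer := by
    rw [← mem_outerBox, hstage.outerBox_eq]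
    exact hcl
  have hvc : χ.inner ≤ |φ.toFun 0| := by
    rw [← not_lt, ← mem_innerBox, hstage.innerBox_eq]
    exact hstage.escape
  have hc0 : |φ.toFun 0| = |H 0| := by rw [hc.apply_zero, abs_sign_mul hc.sign]
  have hvu : χ.inner < χ.outer := hvc.trans_lt hcu
  have hur : χ.outer ≤ φ.inner := by
    have hsub : χ.outerBox ⊆ φ.innerBox := by
      rw [hstage.outerBox_eq]
      exact fun x hx => hx 0 (by omega)
    exact ((Ioo_subset_Ioo_iff (by linarith)).1 hsub).2
  have hvr : χ.inner < φ.inner := hvu.trans_le hur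
  have huX : χ.outer < X := by linarith [hc.outer_le]
  have hχ : ∀ x, |x| < φ.inner → (|x| < χ.inner ↔ |H (x ^ 2)| < χ.outer) := fun x hx => by
    rw [← mem_innerBox, hstage.innerBox_eq, mem_centralPreimage_succ, ← hstage.outerBox_eq,
      mem_outerBox, (hc.eq x hx).2, abs_sign_mul hc.sign]
    exact ⟨fun h => h.2, fun h => ⟨mem_innerBox.2 hx, h⟩⟩
  have h0J := hc.zero_mem
  have hvJ : χ.inner ^ 2 ∈ J := (hc.eq _ (by rwa [abs_of_pos hv0])).1
  -- Otherwise `H` would reach `χ.outer` at some `t < χ.inner ^ 2`, and `√t` would be a point of the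
  -- new central box not sent into the new outer box.
  have hHv : H (χ.inner ^ 2) = χ.outer := by
    have hge : χ.outer ≤ |H (χ.inner ^ 2)| := by
      rw [← not_lt, ← hχ _ (by rwa [abs_of_pos hv0]), abs_of_pos hv0]
      exact lt_irrefl _
    have hgt : H 0 < H (χ.inner ^ 2) := hc.mono h0J hvJ (by positivity)
    have hge' : χ.outer ≤ H (χ.inner ^ 2) := by
      rw [hc0] at hcu
      have := (abs_lt.1 hcu).1
      rcases le_abs.1 hge with h | h <;> linarith
    refine le_antisymm ?_ hge'
    by_contra! hcon
    obtain ⟨t, htJ, ht⟩ := hc.expanding.bijOn.surjOn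
      (show χ.outer ∈ Ioo (-X) X from ⟨by linarith, huX⟩)
    have ht0 : 0 < t := (hc.mono.lt_iff_lt h0J htJ).1 (by
      rw [ht]
      rw [hc0] at hcu
      exact (abs_lt.1 hcu).2)
    have htv : t < χ.inner ^ 2 := (hc.mono.lt_iff_lt htJ hvJ).1 (by rwa [ht])
    have hlt : |√t| < χ.inner := by
      rw [abs_of_nonneg (Real.sqrt_nonneg t)]
      exact (Real.sqrt_lt' hv0).2 htv
    have := (hχ _ (hlt.trans hvr)).1 hlt
    rw [Real.sq_sqrt ht0.le, ht, abs_of_pos (by linarith)] at this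
    exact lt_irrefl _ this
  have hfill := hstage.filling
  refine ⟨⟨hc.sign, hv0, hvu, huX.le, hc.expanding, hc.mono, fun x hx => ?_, fun t ht => ?_⟩, ?_,
    hur, hc0 ▸ hvc⟩
  · obtain ⟨h1, h2⟩ := hc.eq x (hx.trans hvr)
    exact ⟨h1, (hfill.eq_central (mem_innerBox.2 hx)).trans h2⟩
  · rw [← hHv, hc.mono.lt_iff_lt ht hvJ]
  · refine hfill.hasBranches (ρ := φ.inner) hrR.le hvr hur (fun x hx => ?_) ?_
    · refine hc.notMem_escapeDom hb.inner_notMem ?_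
      rw [← hstage.innerBox_eq, innerBox, closure_Ioo (by linarith)]
      exact abs_le.1 hx.le
    · rintro x ⟨⟨i, hi, hlt, hx⟩, -⟩ hxr
      obtain ⟨g, D, hg, hxD, hgx, hD⟩ := hc.exists_escape_branch hb hcl i hi x hlt hx
      have hi0 : 0 < i := by
        rcases Nat.eq_zero_or_pos i with rfl | h
        · exact absurd (mem_innerBox.2 hxr) hx.2
        · exact h
      refine ⟨g, D, hg, hxD, hgx, fun z hz => ?_⟩
      obtain ⟨h1, h2, h3, h4⟩ := hD z hz
      refine ⟨mem_innerBox.1 (h2 0 hi0), fun h => ?_, fun h => ?_, fun h => ?_⟩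
      · rw [hstage.innerBox_eq] at h
        exact h3 (h i hi)
      · rw [hstage.outerBox_eq] at h ⊢
        -- Points of `B^l` stay in `B` through time `l`, so `i > l`; all points of `D` share the
        -- escape time `i` and therefore lie in `B^l`.
        have hli : l < i := by
          by_contra! hcon
          exact hx.2 (h i hcon)
        exact fun j hj => h2 j (by omega)
      · obtain ⟨k1, k2⟩ := h4 h
        exact ⟨⟨i, hi, h2, k1, h3⟩, (escapeMap_eq h2 h3).trans k2⟩

end BoxMap

/-! ### Type I mappings in normal form -/

theorem abs_lt_of_mem_uIcc {a b c r : ℝ} (ha : |a| < r) (hb : |b| = r) (hc : c ∈ uIcc a b)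
    (hcb : c ≠ b) : |c| < r := by
  obtain ⟨h1, h2⟩ := abs_lt.1 ha
  have hr : 0 ≤ r := hb ▸ abs_nonneg b
  rcases (abs_eq hr).1 hb with rfl | rfl
  · rw [uIcc_of_le h2.le] at hc
    exact abs_lt.2 ⟨by linarith [hc.1], lt_of_le_of_ne hc.2 hcb⟩
  · rw [uIcc_of_ge h1.le] at hc
    exact abs_lt.2 ⟨lt_of_le_of_ne hc.1 (Ne.symm hcb), by linarith [hc.2]⟩

namespace BoxMap

variable {φ ψ χ : BoxMap} {σ X Q : ℝ} {H : ℝ → ℝ} {J : Set ℝ}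

theorem IsTypeI.abs_lt_outer (hφ : φ.IsTypeI) {x : ℝ} (hx : |x| < φ.inner) :
    |φ.toFun x| < φ.outer := by
  obtain ⟨h, J, hh, heq⟩ := hφ.central
  obtain ⟨h1, h2⟩ := heq x (mem_innerBox.2 hx)
  have := hh.bijOn.mapsTo h1
  rw [mem_Ioo_neg_iff_abs_lt, add_zero, one_mul] at this
  rwa [h2]

theorem IsTypeI.exists_central (hφ : φ.IsTypeI) {ε : ℝ} (hε : 0 ≤ ε)
    (hext : φ.CentralExtendable ε) : ∃ σ H J, φ.Central σ ((1 + ε) * φ.outer) H J := by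
  obtain ⟨h, J, hh, heq⟩ := hext
  have hcr := hh.crossRatioExpanding
  have hr := hφ.inner_pos
  have hrR := hφ.inner_lt_outer
  obtain ⟨σ, hσ, hmono⟩ : ∃ σ : ℝ, (σ = 1 ∨ σ = -1) ∧ StrictMonoOn (fun x => σ * h x) J := by
    rcases hcr.strict with h' | h'
    · exact ⟨1, Or.inl rfl, by simpa using h'⟩
    · exact ⟨-1, Or.inr rfl, fun a ha b hb hab => by
        have := h' ha hb hab
        simp only
        linarith⟩
  have hH := hcr.sign_mul hσ
  set H := fun x => σ * h x with hHdef
  have hφH : ∀ x, |x| < φ.inner → x ^ 2 ∈ J ∧ φ.toFun x = σ * H (x ^ 2) := fun x hx => by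
    obtain ⟨h1, h2⟩ := heq x (mem_innerBox.2 hx)
    exact ⟨h1, by rw [h2, hHdef, sign_mul_mul hσ]⟩
  have habs : ∀ x, |x| < φ.inner → |H (x ^ 2)| < φ.outer := fun x hx => by
    have := hφ.abs_lt_outer hx
    rwa [(hφH x hx).2, abs_sign_mul hσ] at this
  have h0 : |(0 : ℝ)| < φ.inner := by simpa using hr
  have h0J : (0 : ℝ) ∈ J := by simpa using (hφH 0 h0).1
  have hH0 : |H 0| < φ.outer := by simpa using habs 0 h0
  refine ⟨σ, H, J, hσ, hr, hrR, by nlinarith, hH, hmono, hφH, fun t ht => ⟨fun hlt => ?_,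
    fun hlt => ?_⟩⟩
  · rcases le_or_gt 0 t with ht0 | ht0
    · have := habs (√t) (by
        rw [abs_of_nonneg (Real.sqrt_nonneg t)]
        exact (Real.sqrt_lt' hr).2 hlt)
      rw [Real.sq_sqrt ht0] at this
      exact (abs_lt.1 this).2
    · exact (hmono ht h0J ht0).trans (abs_lt.1 hH0).2
  · by_contra! hcon
    have hrJ : φ.inner ^ 2 ∈ J := hH.ordConnected.out h0J ht ⟨by positivity, hcon⟩
    have hHr : H (φ.inner ^ 2) < φ.outer := (hmono.monotoneOn hrJ ht hcon).trans_lt hlt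
    -- Monotonicity would keep `|φ|` below this maximum up to the endpoint, whereas `central_proper`
    -- makes it tend to `φ.outer`.
    have hmax : max (-H 0) (H (φ.inner ^ 2)) < φ.outer :=
      max_lt (by linarith [(abs_lt.1 hH0).1]) hHr
    refine hmax.not_ge (le_of_tendsto hφ.central_proper ?_)
    filter_upwards [Ioo_mem_nhdsLT hr] with x hx
    have hxr : |x| < φ.inner := by rw [abs_of_pos hx.1]; exact hx.2
    obtain ⟨h1, h2⟩ := hφH x hxr
    rw [h2, abs_sign_mul hσ]
    refine abs_le.2 ⟨?_, le_max_of_le_right (hmono.monotoneOn h1 hrJ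
      (pow_le_pow_left₀ hx.1.le hx.2.le 2))⟩
    have := hmono.monotoneOn h0J h1 (sq_nonneg x)
    linarith [le_max_left (-H 0) (H (φ.inner ^ 2))]

theorem IsTypeI.hasBranches (hφ : φ.IsTypeI) : φ.HasBranches φ.outer where
  innerBox_subset := hφ.innerBox_subset
  inner_notMem := by
    intro x hx
    rcases (abs_eq hφ.inner_pos.le).1 hx with rfl | rfl
    · exact hφ.inner_notMem
    · exact hφ.neg_inner_notMem
  branch := by
    intro x hx
    obtain ⟨g, D, hg, hDout, hCD, heq, himg⟩ := hφ.monotone x hx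
    have hcr := hg.crossRatioExpanding
    have hxC : x ∈ connectedComponentIn φ.dom x := mem_connectedComponentIn hx.1
    have hxD := hCD hxC
    have hval : ∀ y ∈ connectedComponentIn φ.dom x, |g y| < φ.inner := fun y hy => by
      rw [← heq hy, ← mem_innerBox, ← himg]
      exact mem_image_of_mem _ hy
    have hmem : ∀ z ∈ D, |g z| < φ.inner → z ∈ connectedComponentIn φ.dom x := by
      intro z hz h
      rw [← mem_innerBox, ← himg] at h
      obtain ⟨y, hy, hyz⟩ := h
      rw [heq hy] at hyz
      rwa [← hcr.bijOn.injOn (hCD hy) hz hyz]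
    refine ⟨g, D, hcr, hxD, hval x hxC, fun z hz => ⟨mem_outerBox.1 (hDout hz).1,
      not_lt.1 fun h => (hDout hz).2 (mem_innerBox.2 h), fun h =>
      ⟨connectedComponentIn_subset _ _ (hmem z hz h), heq (hmem z hz h)⟩, fun h hdom => ?_⟩⟩
    -- With `z` in the domain, the whole segment from `x` to `z` would be too; then `z` would lie in
    -- the component of `x`, where `|g| < φ.inner`.
    have hsub : uIcc x z ⊆ φ.dom := by
      intro w hw
      rcases eq_or_ne w z with rfl | hne
      · exact hdom
      have hwD : w ∈ D := hcr.ordConnected.uIcc_subset hxD hz hw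
      have hgw : g w ∈ uIcc (g x) (g z) := by
        have hs := hcr.ordConnected.uIcc_subset hxD hz
        rcases hcr.strict with hm | hm
        · exact (hm.monotoneOn.mono hs).mapsTo_uIcc hw
        · exact (hm.antitoneOn.mono hs).mapsTo_uIcc hw
      exact connectedComponentIn_subset _ _ (hmem w hwD (abs_lt_of_mem_uIcc (hval x hxC) h hgw
        fun e => hne (hcr.bijOn.injOn hwD hz e)))
    exact (hval z (isPreconnected_uIcc.subset_connectedComponentIn left_mem_uIcc hsub
      right_mem_uIcc)).ne h

/-! ### Metric estimates for one step -/

namespace StepEstimate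

variable {u v s c E k α : ℝ}

/-- Since `c > 0` and `u ≤ X`, `u + X ≤ 2 * (c + X)` simplifies `fold`; chaining with `right`
cancels `u - E`. The surviving factor `v - k` improves the bound when the new critical value is near
the end of its box. -/
theorem low_bound (h : StepEstimate u v X Q s c E k) (hvQ : v < Q) (huX : u ≤ X)
    (hv : 0 < v) (hlow : v ≤ c) :
    s ^ 2 * ((k + Q) * (Q - v)) ≤ 4 * Q * (v ^ 2 - s ^ 2) * (v - k) := by
  have hw : 0 < v ^ 2 - s ^ 2 := by nlinarith [h.s_lt, h.s_pos]
  have hE := sub_pos.2 h.E_lt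
  have hcE := sub_pos.2 h.c_lt
  have hcX : 0 < c + X := by linarith [h.c_lt, h.E_lt]
  have hk : 0 < k + Q := by linarith [(abs_lt.1 h.abs_k_lt).1]
  have h1 : s ^ 2 * (u - E) ≤ 2 * (E - c) * (v ^ 2 - s ^ 2) := by
    refine le_of_mul_le_mul_right ?_ hcX
    calc s ^ 2 * (u - E) * (c + X) = s ^ 2 * ((c + X) * (u - E)) := by ring
      _ ≤ (E - c) * (u + X) * (v ^ 2 - s ^ 2) := h.fold
      _ ≤ (E - c) * (2 * (c + X)) * (v ^ 2 - s ^ 2) := by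
        gcongr
        linarith
      _ = _ := by ring
  refine le_of_mul_le_mul_right ?_ hE
  calc s ^ 2 * ((k + Q) * (Q - v)) * (u - E) = (s ^ 2 * (u - E)) * ((k + Q) * (Q - v)) := by ring
    _ ≤ (2 * (E - c) * (v ^ 2 - s ^ 2)) * ((k + Q) * (Q - v)) :=
      mul_le_mul_of_nonneg_right h1 (mul_pos hk (sub_pos.2 hvQ)).le
    _ = 2 * (v ^ 2 - s ^ 2) * ((E - c) * ((k + Q) * (Q - v))) := by ring
    _ ≤ 2 * (v ^ 2 - s ^ 2) * ((v - k) * (2 * Q) * (u - E)) :=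
      mul_le_mul_of_nonneg_left h.right (by linarith)
    _ = _ := by ring

/-- Only `fold` is needed, as `[c, E]` lies in `(-u, -v]`: its length is at most `u - v`, while `c +
X ≥ X - u` and `u - E ≥ u`. -/
theorem high_fold_bound (h : StepEstimate u v X Q s c E k) (hv : 0 < v)
    (huX : u ≤ X) (hhigh : E ≤ -v) :
    s ^ 2 * (u * (X - u)) ≤ 2 * X * (u - v) * (v ^ 2 - s ^ 2) := by
  have hw : 0 < v ^ 2 - s ^ 2 := by nlinarith [h.s_lt, h.s_pos]
  have hc := h.neg_lt_c
  have hcE := sub_pos.2 h.c_lt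
  calc s ^ 2 * (u * (X - u)) = s ^ 2 * ((X - u) * u) := by ring
    _ ≤ s ^ 2 * ((c + X) * (u - E)) := by
      refine mul_le_mul_of_nonneg_left ?_ (sq_nonneg s)
      exact mul_le_mul (by linarith) (by linarith) (by linarith) (by linarith)
    _ ≤ (E - c) * (u + X) * (v ^ 2 - s ^ 2) := h.fold
    _ ≤ (u - v) * (2 * X) * (v ^ 2 - s ^ 2) := by
      refine mul_le_mul_of_nonneg_right ?_ hw.le
      exact mul_le_mul (by linarith) (by linarith) (by linarith) (by linarith)
    _ = _ := by ring

theorem high_bound (h : StepEstimate u v X Q s c E k) (hv : 0 < v) (hvu : v < u)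
    (huQ : u ≤ Q) (huX : u ≤ X) (hhigh : E ≤ -v) :
    s ^ 2 * (Q - v) ^ 2 ≤ 16 * Q ^ 2 * (v ^ 2 - s ^ 2) := by
  have hw : 0 < v ^ 2 - s ^ 2 := by nlinarith [h.s_lt, h.s_pos]
  have hu : 0 < u := hv.trans hvu
  have hQ : 0 < Q := hu.trans_le huQ
  have hc := h.neg_lt_c
  have hcE := sub_pos.2 h.c_lt
  have hQv : 0 < Q - v := by linarith
  -- If `X ≥ 2 * u`, the fold has enough room by itself. Otherwise `u + X < 3 * u ≤ 3 * (u - E)`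
  -- cancels `u - E`, and `left` then cancels `c + X`.
  rcases le_or_gt (2 * u) X with h2 | h2
  · have hX : 0 < X := by linarith
    have h1 : s ^ 2 ≤ 4 * (v ^ 2 - s ^ 2) := by
      refine le_of_mul_le_mul_right ?_ (mul_pos hu hX)
      have hf := h.high_fold_bound hv huX hhigh
      have a1 : s ^ 2 * (u * (X / 2)) ≤ s ^ 2 * (u * (X - u)) := by
        gcongr
        linarith
      have a2 : 2 * X * (u - v) * (v ^ 2 - s ^ 2) ≤ 2 * X * u * (v ^ 2 - s ^ 2) := by
        gcongr
        linarith
      linarith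
    calc s ^ 2 * (Q - v) ^ 2 ≤ (4 * (v ^ 2 - s ^ 2)) * Q ^ 2 := by
          gcongr
          linarith
      _ ≤ _ := by nlinarith [mul_pos hw (pow_pos hQ 2)]
  · obtain ⟨hk1, hk2⟩ := abs_lt.1 h.abs_k_lt
    have hcX : 0 < c + X := by linarith
    have h1 : s ^ 2 * (c + X) ≤ 3 * (E - c) * (v ^ 2 - s ^ 2) := by
      have huE : 0 < u - E := sub_pos.2 h.E_lt
      refine le_of_mul_le_mul_right ?_ huE
      calc s ^ 2 * (c + X) * (u - E) = s ^ 2 * ((c + X) * (u - E)) := by ring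
        _ ≤ (E - c) * (u + X) * (v ^ 2 - s ^ 2) := h.fold
        _ ≤ (E - c) * (3 * (u - E)) * (v ^ 2 - s ^ 2) := by
          gcongr
          linarith
        _ = _ := by ring
    have h3 : s ^ 2 * ((k + Q) * (Q - v)) ≤ 6 * Q * (v - k) * (v ^ 2 - s ^ 2) := by
      refine le_of_mul_le_mul_right ?_ hcX
      calc s ^ 2 * ((k + Q) * (Q - v)) * (c + X)
          = (s ^ 2 * (c + X)) * ((k + Q) * (Q - v)) := by ring
        _ ≤ (3 * (E - c) * (v ^ 2 - s ^ 2)) * ((k + Q) * (Q - v)) :=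
          mul_le_mul_of_nonneg_right h1 (mul_pos (by linarith) hQv).le
        _ = 3 * (v ^ 2 - s ^ 2) * ((E - c) * ((k + Q) * (Q - v))) := by ring
        _ ≤ 3 * (v ^ 2 - s ^ 2) * ((v - k) * (2 * Q) * (c + u)) :=
          mul_le_mul_of_nonneg_left h.left (by linarith)
        _ ≤ 3 * (v ^ 2 - s ^ 2) * ((v - k) * (2 * Q) * (c + X)) := by
          have : 0 < v - k := by linarith
          gcongr
        _ = _ := by ring
    calc s ^ 2 * (Q - v) ^ 2 = s ^ 2 * ((Q - v) * (Q - v)) := by ring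
      _ ≤ s ^ 2 * ((k + Q) * (Q - v)) := by
        gcongr
        linarith
      _ ≤ 6 * Q * (v - k) * (v ^ 2 - s ^ 2) := h3
      _ ≤ 6 * Q * (2 * Q) * (v ^ 2 - s ^ 2) := by
        gcongr
        linarith
      _ ≤ _ := by nlinarith [mul_pos hw (pow_pos hQ 2)]

/-- Propagation of the bounds on the box ratios by one step. -/
theorem bounds (h : StepEstimate u v X Q s c E k) (hv : 0 < v) (hvu : v < u) (huQ : u ≤ Q)
    (hQX : Q ≤ X) (hα : 0 < α) (hα' : α ≤ 1 / 5000) (hlow : v ≤ c → v ≤ (1 - α) * Q)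
    (hhigh : E ≤ -v → u ≤ (1 - α) * X ∨ v ≤ 5 / 6 * u) :
    s ≤ (1 - α ^ 2 / 18) * v ∧ (v ≤ (1 - α) * Q ∨ s ≤ 5 / 6 * v) ∧
      (0 < k → s ≤ (1 - α) * v ∨ k ≤ (1 - α) * v) := by
  have huX := huQ.trans hQX
  have hu : 0 < u := hv.trans hvu
  have hQ : 0 < Q := hu.trans_le huQ
  have hX : 0 < X := hQ.trans_le hQX
  have hs := h.s_pos
  have hw : 0 < v ^ 2 - s ^ 2 := by nlinarith [h.s_lt, h.s_pos]
  obtain ⟨hk1, hk2⟩ := abs_lt.1 h.abs_k_lt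
  have hvQ : v < Q := hvu.trans_le huQ
  have hv2 : 0 < v ^ 2 := pow_pos hv 2
  rcases h.side with hside | hside
  · have hvα := hlow hside
    have hb := h.low_bound hvQ huX hv hside
    have hQv : α * Q ≤ Q - v := by linarith
    have hαQ : 0 < α * Q := mul_pos hα hQ
    refine ⟨?_, Or.inl hvα, fun hk => ?_⟩
    · have h1 : s ^ 2 * α ^ 2 ≤ 8 * (v ^ 2 - s ^ 2) := by
        refine le_of_mul_le_mul_right ?_ (pow_pos hQ 2)
        calc s ^ 2 * α ^ 2 * Q ^ 2 = s ^ 2 * ((α * Q) * (α * Q)) := by ring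
          _ ≤ s ^ 2 * ((k + Q) * (Q - v)) := by gcongr <;> linarith
          _ ≤ 4 * Q * (v ^ 2 - s ^ 2) * (v - k) := hb
          _ ≤ 4 * Q * (v ^ 2 - s ^ 2) * (2 * Q) := by
            gcongr
            linarith
          _ = _ := by ring
      have hα2 : α ^ 2 ≤ 1 := by nlinarith
      refine le_of_sq_le_sq ?_ (mul_nonneg (by nlinarith) hv.le)
      have h2 : s ^ 2 * (8 + α ^ 2) ≤ 8 * v ^ 2 := by linarith
      -- Since `(1 - α ^ 2 / 18) ^ 2 ≥ 1 - α ^ 2 / 9`, the slack is at least `α ^ 2 * (1 - α ^ 2) /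
      -- 9`.
      have h3 : (8 : ℝ) ≤ (1 - α ^ 2 / 18) ^ 2 * (8 + α ^ 2) := by
        have : 0 ≤ α ^ 2 * (1 - α ^ 2) := mul_nonneg (sq_nonneg _) (by linarith)
        nlinarith [mul_nonneg (sq_nonneg (α ^ 2)) (sq_nonneg α)]
      refine le_of_mul_le_mul_right ?_ (by positivity : 0 < 8 + α ^ 2)
      have := mul_le_mul_of_nonneg_left h3 hv2.le
      linarith
    · by_contra! hcon
      obtain ⟨hs1, hk3⟩ := hcon
      -- Here `v - k ≤ α * Q` compensates for `Q - v ≥ α * Q`: the factor `α` cancels, and `s ≤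
      -- √(4/5) * v` contradicts `s > (1 - α) * v`.
      have h1 : s ^ 2 ≤ 4 * (v ^ 2 - s ^ 2) := by
        refine le_of_mul_le_mul_right ?_ (mul_pos hα (pow_pos hQ 2))
        calc s ^ 2 * (α * Q ^ 2) = s ^ 2 * (Q * (α * Q)) := by ring
          _ ≤ s ^ 2 * ((k + Q) * (Q - v)) := by
            gcongr
            linarith
          _ ≤ 4 * Q * (v ^ 2 - s ^ 2) * (v - k) := hb
          _ ≤ 4 * Q * (v ^ 2 - s ^ 2) * (α * Q) := by
            gcongr
            nlinarith
          _ = _ := by ring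
      have h2 : (9 / 10 * v) < s := by nlinarith
      nlinarith
  · have hf := h.high_fold_bound hv huX hside
    have hb := h.high_bound hv hvu huQ huX hside
    have hmain : s ≤ (1 - α) * v ∧ (v ≤ (1 - α) * Q ∨ s ≤ 5 / 6 * v) := by
      -- a definite gap between the old boxes gives a definite gap between the new ones
      have hgap : v ≤ 5 / 6 * Q → s ≤ (1 - α) * v := by
        intro hvQ'
        -- `576 = 16 * 6 ^ 2`; the resulting `s ^ 2 ≤ (576 / 577) * v ^ 2` is what `α ≤ 1 / 5000`
        -- accommodates.
        have h1 : s ^ 2 ≤ 576 * (v ^ 2 - s ^ 2) := by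
          refine le_of_mul_le_mul_right ?_ (pow_pos hQ 2)
          have : s ^ 2 * (Q / 6) ^ 2 ≤ s ^ 2 * (Q - v) ^ 2 := by
            gcongr
            linarith
          linarith
        by_contra! hcon
        have : (4999 / 5000 * v) < s := by nlinarith
        nlinarith
      rcases hhigh hside with hcase | hcase
      · have hf' : s ^ 2 * (u * α) ≤ 2 * (u - v) * (v ^ 2 - s ^ 2) := by
          refine le_of_mul_le_mul_right ?_ hX
          calc s ^ 2 * (u * α) * X = s ^ 2 * (u * (α * X)) := by ring
            _ ≤ s ^ 2 * (u * (X - u)) := by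
              gcongr
              linarith
            _ ≤ _ := hf
            _ = _ := by ring
        rcases le_or_gt ((1 - α) * u) v with hd | hd
        -- When the old boxes are nearly equal, `u - v ≤ α * u` cancels `α`. The alternative `5/6`
        -- comes from `√(2/3) < 5/6`.
        · have h1 : s ^ 2 ≤ 2 * (v ^ 2 - s ^ 2) := by
            refine le_of_mul_le_mul_right ?_ (mul_pos hu hα)
            calc s ^ 2 * (u * α) ≤ 2 * (u - v) * (v ^ 2 - s ^ 2) := hf'
              _ ≤ 2 * (α * u) * (v ^ 2 - s ^ 2) := by
                gcongr
                linarith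
              _ = _ := by ring
          have h2 : s ≤ 5 / 6 * v := by
            refine le_of_sq_le_sq ?_ (by linarith)
            nlinarith
          exact ⟨by nlinarith, Or.inr h2⟩
        · refine ⟨?_, Or.inl (hd.le.trans (mul_le_mul_of_nonneg_left huQ (by linarith)))⟩
          rcases le_or_gt v (5 / 6 * u) with hd2 | hd2
          · exact hgap (by linarith)
          · have h1 : s ^ 2 * α ≤ 1 / 3 * (v ^ 2 - s ^ 2) := by
              refine le_of_mul_le_mul_right ?_ hu
              calc s ^ 2 * α * u = s ^ 2 * (u * α) := by ring
                _ ≤ 2 * (u - v) * (v ^ 2 - s ^ 2) := hf'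
                _ ≤ 2 * (1 / 6 * u) * (v ^ 2 - s ^ 2) := by
                  gcongr
                  linarith
                _ = _ := by ring
            have h2 : s ^ 2 * (1 + 3 * α) ≤ v ^ 2 := by linarith
            refine le_of_sq_le_sq ?_ (mul_nonneg (by linarith) hv.le)
            have h3 : (1 : ℝ) ≤ (1 - α) ^ 2 * (1 + 3 * α) := by
              nlinarith [mul_pos hα hα, mul_pos hα (mul_pos hα hα)]
            refine le_of_mul_le_mul_right ?_ (by linarith : 0 < 1 + 3 * α)
            have := mul_le_mul_of_nonneg_left h3 hv2.le
            linarith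
      · have hvQ' : v ≤ 5 / 6 * Q := by linarith
        exact ⟨hgap hvQ', Or.inl (by nlinarith)⟩
    refine ⟨hmain.1.trans ?_, hmain.2, fun _ => Or.inl hmain.1⟩
    refine mul_le_mul_of_nonneg_right ?_ hv.le
    nlinarith

end StepEstimate

/-! ### The invariant and the induction on steps -/

/-- The bounds that are preserved by standard inducing steps. -/
def BoundedGeometry (α : ℝ) (φ : BoxMap) : Prop :=
  ∃ (σ X : ℝ) (H : ℝ → ℝ) (J : Set ℝ), φ.Central σ X H J ∧ φ.HasBranches φ.outer ∧
    φ.inner ≤ (1 - α ^ 2 / 18) * φ.outer ∧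
    (φ.outer ≤ (1 - α) * X ∨ φ.inner ≤ 5 / 6 * φ.outer) ∧
    (0 < H 0 → φ.inner ≤ (1 - α) * φ.outer ∨ H 0 ≤ (1 - α) * φ.outer)

theorem IsNonCloseStep.boundedGeometry {α : ℝ} (hα : 0 < α) (hα' : α ≤ 1 / 5000)
    (hstep : IsNonCloseStep φ ψ) (hc : φ.Central σ X H J) (hb : φ.HasBranches Q)
    (hQ : φ.outer ≤ Q) (hQX : Q ≤ X)
    (hlow : φ.inner ≤ H 0 → φ.inner ≤ (1 - α) * Q)
    (hhigh : φ.outer ≤ (1 - α) * X ∨ φ.inner ≤ 5 / 6 * φ.outer) :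
    BoundedGeometry α ψ := by
  obtain ⟨σ', H', J', E, hc', hb', hest⟩ := hstep.exists_central hc hb hQ
  obtain ⟨h1, h2, h3⟩ := hest.bounds hc.inner_pos hc.inner_lt_outer hQ hQX hα hα' hlow
    fun _ => hhigh
  rw [← hstep.outer_eq] at h1 h2 h3
  exact ⟨σ', Q, H', J', hc', hb', h1, h2, h3⟩

/-- For a low return the central box is bounded by the critical value, so both alternatives on `H 0`
bound it. After a close stage the outer box lies in the old central box, and `5 / 6 ≤ 1 - α` turns
either first alternative into room for the extension. -/
theorem BoundedGeometry.step {α : ℝ} (hα : 0 < α) (hα' : α ≤ 1 / 5000)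
    (hφ : BoundedGeometry α φ) (hstep : IsStandardStep φ ψ) : BoundedGeometry α ψ := by
  obtain ⟨σ, X, H, J, hc, hb, -, h2, h3⟩ := hφ
  have hr := hc.inner_pos
  have hrR := hc.inner_lt_outer
  have hRX := hc.outer_le
  rcases hstep with hstep | ⟨l, χ, hstage, hstep⟩
  · exact hstep.boundedGeometry hα hα' hc hb le_rfl hRX
      (fun h => (h3 (hr.trans_le h)).elim id h.trans) h2
  · obtain ⟨hcχ, hbχ, hout, hin⟩ := hstage.exists_central hc hb
    have hvu := hcχ.inner_lt_outer
    refine hstep.boundedGeometry hα hα' hcχ hbχ (hout.trans hrR.le) hRX (fun h => ?_)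
      (Or.inl ?_)
    · rcases h3 (hcχ.inner_pos.trans_le h) with h' | h'
      · linarith
      · exact h.trans h'
    · rcases h2 with h' | h'
      · linarith
      · nlinarith

theorem ObtainedBySteps.boundedGeometry {α : ℝ} (hα : 0 < α) (hα' : α ≤ 1 / 5000)
    (hφ : BoundedGeometry α φ) {n m : ℕ} (h : ObtainedBySteps φ n m ψ) :
    BoundedGeometry α ψ := by
  induction h with
  | refl => exact hφ
  | step _ hstep ih => exact ih.step hα hα' hstep

theorem BoundedGeometry.ratio_le {α : ℝ} (hφ : BoundedGeometry α φ) :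
    φ.ratio ≤ 1 - α ^ 2 / 18 := by
  obtain ⟨σ, X, H, J, hc, -, h, -⟩ := hφ
  have : 0 < φ.outer := hc.inner_pos.trans hc.inner_lt_outer
  rw [ratio, div_le_iff₀ (by linarith)]
  linarith

/-- A positive ratio forces `ε < 1`, whence `(1 - α) * (1 + ε) ≥ 1` for `α ≤ ε / 2`: the outer box
is well inside the range of extension. -/
theorem IsTypeI.boundedGeometry (hφ : φ.IsTypeI) {ε α : ℝ} (hε : 0 < ε)
    (hratio : φ.ratio ≤ 1 - ε) (hext : φ.CentralExtendable ε) (hα : 0 < α) (hα' : α ≤ 1)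
    (hαε : α ≤ ε / 2) : BoundedGeometry α φ := by
  obtain ⟨σ, H, J, hc⟩ := hφ.exists_central hε.le hext
  have hR : 0 < φ.outer := hφ.inner_pos.trans hφ.inner_lt_outer
  rw [ratio, div_le_iff₀ (by linarith)] at hratio
  have hle : φ.inner ≤ (1 - ε) * φ.outer := by linarith
  have hε1 : ε < 1 := by
    by_contra! hcon
    nlinarith [hφ.inner_pos]
  refine ⟨σ, _, H, J, hc, hφ.hasBranches, ?_, Or.inl ?_, fun _ => Or.inl ?_⟩
  · refine hle.trans (mul_le_mul_of_nonneg_right ?_ hR.le)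
    nlinarith
  · have : 1 ≤ (1 - α) * (1 + ε) := by nlinarith
    nlinarith
  · refine hle.trans (mul_le_mul_of_nonneg_right ?_ hR.le)
    linarith

end BoxMap

theorem mainTheorem9 :
    ∃ K : ℝ → ℝ, Continuous K ∧ (∀ ε : ℝ, 0 < ε → 0 < K ε) ∧
      ∀ (ε : ℝ), 0 < ε → ∀ (n m : ℕ) (φ ψ : BoxMap),
        φ.IsTypeI → φ.ratio ≤ 1 - ε → φ.CentralExtendable ε →
        BoxMap.ObtainedBySteps φ n m ψ →
        ψ.ratio ≤ 1 - K ε := by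
  have hpos : ∀ ε : ℝ, 0 < ε → 0 < min (1 / 5000) (ε / 2) := fun ε hε =>
    lt_min (by norm_num) (by linarith)
  -- The bound `1 / 5000` serves the propagation and `ε / 2` the initial mapping.
  refine ⟨fun ε => min (1 / 5000) (ε / 2) ^ 2 / 18, by fun_prop, fun ε hε => ?_, ?_⟩
  · have := hpos ε hε
    positivity
  · intro ε hε n m φ ψ hφ hratio hext hsteps
    have hα := hpos ε hε
    have hα' : min (1 / 5000) (ε / 2) ≤ 1 / 5000 := min_le_left _ _
    exact (hsteps.boundedGeometry hα hα' (hφ.boundedGeometry hε hratio hext hα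
      (hα'.trans (by norm_num)) (min_le_right _ _))).ratio_le
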